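/- Let $N\ge 1$ be an integer and let $u\in C_c^\infty(\mathbb R^N)$ be real-valued. Write $B_r(x)$ for the open ball of radius $r$ centred at $x$, and put $$\kappa_1(s)=2^{-2s}\pi^{-N/2}\frac{\Gamma(\frac{N-2s}{2})}{\Gamma(1+s)},\qquad \kappa_2(s)=2^{-2s}\frac{\Gamma(\frac{N-2s}{2})}{\Gamma(\frac N2)\,\Gamma(1+s)} .$$ **Logarithmic Laplacians.** For a function $v$ on $\mathbb R^N$ let $\mathcal K_0v=v$ and, for $n\ge1$, $$\mathcal K_n v(x)=\int_{\mathbb R^N}\big(v(x)1_{B_1(x)}(y)-v(y)\big)\,|x-y|^{-N}\big(-2\ln|x-y|\big)^{n-1}\,dy .$$ For $m\ge1$ let $\mathcal L_m v=\sum_{j=0}^m\alpha_j\mathcal K_j v$, where $$\alpha_0=(-1)^m\kappa_2^{(m)}(0),\qquad \alpha_j=m(-1)^{m+j}\binom{m-1}{j-1}\kappa_1^{(m-j)}(0)\quad(1\le j\le m).$$ **The family $\mathcal B^s$.** For $s\in(-\frac N2,0)$ let $\mathcal B^su=\Phi_{-s}*u$, where, for $t\in(0,\frac N2)$, $\Phi_t(z)=\kappa_1(t)\,t\,|z|^{2t-N}$.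 For $s\ge0$ let $\mathcal B^su=(-\Delta)^su=(-\Delta)^{s-[s]}\big((-\Delta)^{[s]}u\big)$, where $[s]$ is the integer part of $s$, $(-\Delta)^0$ is the identity (so $\mathcal B^0u=u$), and, for $\sigma\in(0,1)$, $$(-\Delta)^\sigma v(x)=c_{N,\sigma}\lim_{\epsilon\to0^+}\int_{\mathbb R^N\setminus B_\epsilon(x)}\frac{v(x)-v(y)}{|x-y|^{N+2\sigma}}\,dy,\qquad c_{N,\sigma}=2^{2\sigma}\pi^{-N/2}\sigma\,\frac{\Gamma(\frac{N+2\sigma}{2})}{\Gamma(1-\sigma)} .$$ Then for every $x\in\mathbb R^N$ the following hold. 1. All these expressions are well defined: for every $s\in(-\frac N2,\infty)$ the integral (absolutely), respectively the limit of absolutely convergent truncated integrals, defining $\mathcal B^su(x)$ converges; and for every $s_0\in(-\frac N2,\infty)$ and every $j\ge1$ the integral defining $\mathcal K_j(\mathcal B^{s_0}u)(x)$ converges absolutely. 2. For every integer $n\ge1$, $$\mathcal B^su(x)=u(x)+\sum_{m=1}^n\frac{s^m}{m!}\,\mathcal L_mu(x)+o(s^n)\qquad\text{as } s\to0 .$$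 3. For every $s_0\in(-\frac N2,\infty)$ and every integer $n\ge1$, $$\mathcal B^su(x)=\mathcal B^{s_0}u(x)+\sum_{m=1}^n\frac{(s-s_0)^m}{m!}\,\mathcal L_m\big(\mathcal B^{s_0}u\big)(x)+o\big((s-s_0)^n\big)\qquad\text{as } s\to s_0 .$$ The limits $s\to0$ and $s\to s_0$ are two-sided. -/

import Mathlib

open Real Set Filter Topology MeasureTheory Asymptotics
open scoped ContDiff

noncomputable section

namespace LogLap

/-- Euclidean space `ℝ^N`. -/
abbrev Sp (N : ℕ) : Type := EuclideanSpace ℝ (Fin N)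

/-- `κ_{N,s} = 2^{-2s} π^{-N/2} Γ((N-2s)/2) / Γ(1+s) · s`, the normalization of the Riesz kernel. -/
def kappa (N : ℕ) (s : ℝ) : ℝ :=
  (2 : ℝ) ^ (-2 * s) * π ^ (-(N : ℝ) / 2) *
    (Real.Gamma (((N : ℝ) - 2 * s) / 2) / Real.Gamma (1 + s)) * s

/-- The Riesz kernel `Φ_s(z) = κ_{N,s} |z|^{2s-N}`. -/
def rieszKernel (N : ℕ) (s : ℝ) (z : Sp N) : ℝ :=
  kappa N s * ‖z‖ ^ (2 * s - (N : ℝ))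

/-- The Riesz potential `(Φ_s ∗ u)(x) = ∫ Φ_s(x-y) u(y) dy`. -/
def rieszPotential (N : ℕ) (s : ℝ) (u : Sp N → ℝ) (x : Sp N) : ℝ :=
  ∫ y, rieszKernel N s (x - y) * u y

/-- `c_{N,s} = 2^{2s} π^{-N/2} s Γ((N+2s)/2) / Γ(1-s)`, the normalization of `(-Δ)^s`. -/
def fracConst (N : ℕ) (s : ℝ) : ℝ :=
  (2 : ℝ) ^ (2 * s) * π ^ (-(N : ℝ) / 2) * s *
    (Real.Gamma (((N : ℝ) + 2 * s) / 2) / Real.Gamma (1 - s))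

/-- The integrand `(u(x) - u(y)) / |x-y|^{N+2s}` of the fractional Laplacian. -/
def fracIntegrand (N : ℕ) (s : ℝ) (u : Sp N → ℝ) (x y : Sp N) : ℝ :=
  (u x - u y) / ‖x - y‖ ^ ((N : ℝ) + 2 * s)

/-- The truncated integral `∫_{ℝ^N ∖ B_ε(x)} (u(x) - u(y)) / |x-y|^{N+2s} dy`. -/
def fracTruncated (N : ℕ) (s : ℝ) (u : Sp N → ℝ) (x : Sp N) (ε : ℝ) : ℝ :=
  ∫ y in (Metric.ball x ε)ᶜ, fracIntegrand N s u x y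

/-- The fractional Laplacian `(-Δ)^s u(x)` of order `s ∈ (0,1)`, as a singular integral. -/
def fracLaplacian (N : ℕ) (s : ℝ) (u : Sp N → ℝ) (x : Sp N) : ℝ :=
  fracConst N s * limUnder (𝓝[>] (0 : ℝ)) (fracTruncated N s u x)

/-- The integer power `(-Δ)^k`, the `k`-fold iterate of `-Δ`. -/
def negLaplacianPow (N : ℕ) (k : ℕ) (u : Sp N → ℝ) : Sp N → ℝ :=
  (fun v : Sp N → ℝ => fun x => -(Laplacian.laplacian v x))^[k] u

open Classical in
/-- `(-Δ)^s = (-Δ)^{s-[s]} ∘ (-Δ)^{[s]}` for `s ≥ 0`, where `(-Δ)^0` is the identity. -/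
def laplacianPow (N : ℕ) (s : ℝ) (u : Sp N → ℝ) : Sp N → ℝ :=
  if Int.fract s = 0 then negLaplacianPow N ⌊s⌋₊ u
  else fracLaplacian N (Int.fract s) (negLaplacianPow N ⌊s⌋₊ u)

open Classical in
/-- `𝓑^s u = Φ_{-s} ∗ u` for `-N/2 < s < 0`, and `𝓑^s u = (-Δ)^s u` for `s ≥ 0`
(so `𝓑^0 u = u`). -/
def B (N : ℕ) (s : ℝ) (u : Sp N → ℝ) : Sp N → ℝ :=
  if s < 0 then rieszPotential N (-s) u else laplacianPow N s u

/-- The integral, or the principal value, that defines `𝓑^s u(x)` converges: the convolution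
integral converges absolutely for `s < 0`; for a non-integer `s > 0` the truncated integrals
converge absolutely and have a finite limit. -/
def BConvergesAt (N : ℕ) (s : ℝ) (u : Sp N → ℝ) (x : Sp N) : Prop :=
  (s < 0 → Integrable (fun y => rieszKernel N (-s) (x - y) * u y)) ∧
  (0 < s → Int.fract s ≠ 0 →
    (∀ ε : ℝ, 0 < ε → IntegrableOn
      (fracIntegrand N (Int.fract s) (negLaplacianPow N ⌊s⌋₊ u) x) (Metric.ball x ε)ᶜ) ∧
    ∃ l : ℝ, Tendsto (fracTruncated N (Int.fract s) (negLaplacianPow N ⌊s⌋₊ u) x)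
      (𝓝[>] 0) (𝓝 l))

/-- `κ₁(s) = 2^{-2s} π^{-N/2} Γ((N-2s)/2) / Γ(1+s)`. -/
def kappa₁ (N : ℕ) (s : ℝ) : ℝ :=
  (2 : ℝ) ^ (-2 * s) * π ^ (-(N : ℝ) / 2) *
    (Real.Gamma (((N : ℝ) - 2 * s) / 2) / Real.Gamma (1 + s))

/-- `κ₂(s) = 2^{-2s} Γ((N-2s)/2) / (Γ(N/2) Γ(1+s))`. -/
def kappa₂ (N : ℕ) (s : ℝ) : ℝ :=
  (2 : ℝ) ^ (-2 * s) *
    (Real.Gamma (((N : ℝ) - 2 * s) / 2) / (Real.Gamma ((N : ℝ) / 2) * Real.Gamma (1 + s)))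

/-- `q_n(t) = t^{-N} (-2 ln t)^{n-1}`, for `n ≥ 1` and `t > 0`. -/
def q (N n : ℕ) (t : ℝ) : ℝ :=
  t ^ (-(N : ℝ)) * (-2 * Real.log t) ^ (n - 1)

/-- The integrand `(v(x) 1_{B_1(x)}(y) - v(y)) q_n(|x-y|)` of `𝓚_n v(x)`. -/
def KIntegrand (N n : ℕ) (v : Sp N → ℝ) (x y : Sp N) : ℝ :=
  ((Metric.ball x 1).indicator (fun _ => v x) y - v y) * q N n ‖x - y‖

/-- `𝓚_0 v = v` and `𝓚_n v(x) = ∫ (v(x) 1_{B_1(x)}(y) - v(y)) q_n(|x-y|) dy` for `n ≥ 1`. -/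
def K (N : ℕ) : ℕ → (Sp N → ℝ) → Sp N → ℝ
  | 0, v, x => v x
  | n + 1, v, x => ∫ y, KIntegrand N (n + 1) v x y

/-- The coefficients of `𝓛_m`: `α_0 = (-1)^m κ₂^{(m)}(0)` and
`α_j = m (-1)^{m+j} C(m-1, j-1) κ₁^{(m-j)}(0)` for `1 ≤ j ≤ m`. -/
def alpha (N m : ℕ) : ℕ → ℝ
  | 0 => (-1) ^ m * iteratedDeriv m (kappa₂ N) 0
  | j + 1 => (m : ℝ) * (-1) ^ (m + (j + 1)) * ((m - 1).choose j : ℝ) *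
      iteratedDeriv (m - (j + 1)) (kappa₁ N) 0

/-- The `m`-order logarithmic Laplacian `𝓛_m = ∑_{j=0}^m α_j 𝓚_j`, for `m ≥ 1`. -/
def L (N m : ℕ) (v : Sp N → ℝ) (x : Sp N) : ℝ :=
  ∑ j ∈ Finset.range (m + 1), alpha N m j * K N j v x

end LogLap

end

open LogLap
open scoped SchwartzMap FourierTransform

/-! For every s > -N/2 the operator 𝓑^s is the Fourier multiplier |2πξ|^{2s}. Hence, with s = s₀ +
σ, the value 𝓑^s u(x) is an exponential integral ∫ F e^{σℓ} with ℓ = 2 ln(2π|ξ|), which may be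
expanded under the integral sign on both sides of σ = 0 (`hasExpansion_integral_mul_exp`,
`exists_hasExpansion_B`). This yields a two-sided asymptotic series, but its coefficients are
Fourier integrals rather than 𝓛_m.

The coefficients are identified from σ > 0 alone. Put v = 𝓑^{s₀}u. The multiplier identity gives
𝓑^{s₀+σ}u = (-Δ)^σ v, and cutting the singular integral at the unit ball (`fracConst_mul_limit_eq`)
turns this into κ₂(-σ) v(x) + σ κ₁(-σ) ∫ (v(x) 1_{B_1(x)}(y) - v(y)) |x-y|^{-N} e^{σ(-2 ln|x-y|)}
dy. The last integral is again exponential, with coefficients 𝓚_{k+1}v(x)/k!. Its Cauchy product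
with the Taylor series of κ₁ and κ₂ has the coefficients 𝓛_m v(x)/m! (`coeff_eq_L_div_factorial`).
An asymptotic series is determined by the right-hand germ of the function (`HasExpansion.unique`),
so the two-sided series has these coefficients; nothing need be computed for σ < 0.

The analytic input is twofold. The multiplier identities with their exact constants
(`kappa_mul_integral_eq`, `tendsto_fracTruncated`) come from writing powers of |z| as superpositions
of Gaussians. The 𝓚 integrals converge because v is Lipschitz, which tames the singularity, and
decays polynomially (`bSpec`), which tames infinity. -/

/-- `f` has the asymptotic power series `∑ c k * σ ^ k` along the filter `l`. -/
def HasExpansion (l : Filter ℝ) (f : ℝ → ℝ) (c : ℕ → ℝ) : Prop :=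
  ∀ n : ℕ, (fun σ => f σ - ∑ k ∈ Finset.range n, c k * σ ^ k) =O[l] (fun σ => σ ^ n)

/-! ### Algebra and uniqueness of asymptotic power series -/

namespace HasExpansion

variable {l l' : Filter ℝ} {f g : ℝ → ℝ} {c d : ℕ → ℝ}

lemma mono (h : HasExpansion l f c) (hl : l' ≤ l) : HasExpansion l' f c :=
  fun n => (h n).mono hl

lemma congr' (h : HasExpansion l f c) (hfg : f =ᶠ[l] g) : HasExpansion l g c := fun n =>
  (h n).congr' (hfg.mono fun σ hσ => by simp only [hσ]) EventuallyEq.rfl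

lemma add (hf : HasExpansion l f c) (hg : HasExpansion l g d) :
    HasExpansion l (fun σ => f σ + g σ) (fun k => c k + d k) := fun n => by
  refine ((hf n).add (hg n)).congr_left fun σ => ?_
  simp only [add_mul, Finset.sum_add_distrib]
  ring

lemma mul_const (hf : HasExpansion l f c) (a : ℝ) :
    HasExpansion l (fun σ => f σ * a) (fun k => c k * a) := fun n => by
  refine ((hf n).const_mul_left a).congr_left fun σ => ?_
  rw [mul_sub, Finset.mul_sum, mul_comm a]
  congr 1
  exact Finset.sum_congr rfl fun k _ => by ring

/-- Needed because κ₁ and κ₂ enter the singular integral at -σ; this is the source of the signs in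
`alpha`. -/
lemma comp_neg (hf : HasExpansion (𝓝 0) f c) :
    HasExpansion (𝓝 0) (fun σ => f (-σ)) (fun k => (-1) ^ k * c k) := fun n => by
  have ht : Tendsto (fun σ : ℝ => -σ) (𝓝 0) (𝓝 0) := by
    simpa using (continuous_neg.tendsto (0 : ℝ))
  have h := (hf n).comp_tendsto ht
  refine (h.congr_left fun σ => ?_).trans (IsBigO.of_bound 1
    (Eventually.of_forall fun σ => by simp))
  simp only [Function.comp]
  congr 1
  exact Finset.sum_congr rfl fun k _ => by rw [neg_pow]; ring

lemma isBigO_pow_of_le (hl : l ≤ 𝓝 0) {m n : ℕ} (h : n ≤ m) :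
    (fun σ : ℝ => σ ^ m) =O[l] (fun σ => σ ^ n) := by
  refine IsBigO.of_bound 1 (hl ?_)
  filter_upwards [Metric.closedBall_mem_nhds (0 : ℝ) one_pos] with σ hσ
  rw [mem_closedBall_zero_iff] at hσ
  rw [norm_pow, norm_pow, one_mul]
  exact pow_le_pow_of_le_one (norm_nonneg _) hσ h

lemma isBigO_one (hf : HasExpansion l f c) : f =O[l] (fun _ => (1 : ℝ)) := by
  simpa using hf 0

lemma id_mul (hl : l ≤ 𝓝 0) (hf : HasExpansion l f c) :
    HasExpansion l (fun σ => σ * f σ) (fun k => Nat.casesOn k 0 c) := fun n => by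
  cases n with
  | zero =>
    simpa using (isBigO_pow_of_le hl zero_le_one).mul hf.isBigO_one
  | succ n =>
    refine ((isBigO_refl (fun σ : ℝ => σ) l).mul (hf n)).congr (fun σ => ?_) fun σ => ?_
    · rw [Finset.sum_range_succ', mul_sub, Finset.mul_sum]
      change _ = σ * f σ - (∑ k ∈ Finset.range n, c k * σ ^ (k + 1) + 0 * σ ^ 0)
      rw [zero_mul, add_zero]
      exact congrArg _ (Finset.sum_congr rfl fun k _ => by rw [pow_succ]; ring)
    · ring

lemma _root_.Finset.sum_range_sum_antidiagonal (F : ℕ → ℕ → ℝ) (n : ℕ) :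
    ∑ k ∈ Finset.range n, ∑ p ∈ Finset.HasAntidiagonal.antidiagonal k, F p.1 p.2 =
      ∑ p ∈ (Finset.range n ×ˢ Finset.range n).filter (fun p => p.1 + p.2 < n), F p.1 p.2 := by
  rw [← Finset.sum_fiberwise_of_maps_to (t := Finset.range n) (g := fun p : ℕ × ℕ => p.1 + p.2)
    (fun p hp => by simpa using (Finset.mem_filter.1 hp).2)]
  refine Finset.sum_congr rfl fun k hk => Finset.sum_congr ?_ fun _ _ => rfl
  ext p
  simp only [Finset.HasAntidiagonal.mem_antidiagonal, Finset.mem_filter, Finset.mem_product, Finset.mem_range]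
    at hk ⊢
  omega

/-- With partial sums P, Q, the error is (f - P)g + P(g - Q) plus the terms of PQ of degree at least
n; each is O(σ^n) because σ stays bounded along `l`. -/
lemma mul (hl : l ≤ 𝓝 0) (hf : HasExpansion l f c) (hg : HasExpansion l g d) :
    HasExpansion l (fun σ => f σ * g σ)
      (fun k => ∑ p ∈ Finset.HasAntidiagonal.antidiagonal k, c p.1 * d p.2) := fun n => by
  have hP : (fun σ => ∑ k ∈ Finset.range n, c k * σ ^ k) =O[l] (fun _ => (1 : ℝ)) := by
    have h1 := (hf n).trans (isBigO_pow_of_le hl (Nat.zero_le n))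
    simp only [pow_zero] at h1
    exact (hf.isBigO_one.sub h1).congr_left fun σ => by ring
  have h1 : (fun σ => (f σ - ∑ k ∈ Finset.range n, c k * σ ^ k) * g σ) =O[l] fun σ => σ ^ n := by
    simpa using (hf n).mul hg.isBigO_one
  have h2 : (fun σ => (∑ k ∈ Finset.range n, c k * σ ^ k) *
      (g σ - ∑ k ∈ Finset.range n, d k * σ ^ k)) =O[l] fun σ => σ ^ n := by
    simpa using hP.mul (hg n)
  have h3 : (fun σ => ∑ p ∈ (Finset.range n ×ˢ Finset.range n).filter (fun p => ¬ p.1 + p.2 < n),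
      c p.1 * d p.2 * σ ^ (p.1 + p.2)) =O[l] fun σ => σ ^ n := by
    refine IsBigO.fun_sum fun p hp => ?_
    exact (isBigO_pow_of_le hl (not_lt.1 (Finset.mem_filter.1 hp).2)).const_mul_left _
  refine ((h1.add h2).add h3).congr_left fun σ => ?_
  have h4 : (∑ k ∈ Finset.range n, c k * σ ^ k) * (∑ k ∈ Finset.range n, d k * σ ^ k) =
      ∑ p ∈ Finset.range n ×ˢ Finset.range n, c p.1 * d p.2 * σ ^ (p.1 + p.2) := by
    rw [Finset.sum_mul_sum, Finset.sum_product]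
    exact Finset.sum_congr rfl fun i _ => Finset.sum_congr rfl fun j _ => by ring
  have h5 : ∑ k ∈ Finset.range n, (∑ p ∈ Finset.HasAntidiagonal.antidiagonal k, c p.1 * d p.2) * σ ^ k =
      ∑ k ∈ Finset.range n, ∑ p ∈ Finset.HasAntidiagonal.antidiagonal k, c p.1 * d p.2 * σ ^ (p.1 + p.2) := by
    refine Finset.sum_congr rfl fun k _ => ?_
    rw [Finset.sum_mul]
    exact Finset.sum_congr rfl fun p hp => by rw [Finset.HasAntidiagonal.mem_antidiagonal.1 hp]
  have h6 := Finset.sum_filter_add_sum_filter_not (Finset.range n ×ˢ Finset.range n)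
    (fun p => p.1 + p.2 < n) (fun p => c p.1 * d p.2 * σ ^ (p.1 + p.2))
  rw [h5, Finset.sum_range_sum_antidiagonal (fun i j => c i * d j * σ ^ (i + j)), mul_sub, h4]
  linarith

/-- If all earlier coefficients agree, |c n - d n| σ^n = O(σ^{n+1}); dividing by σ^n and letting σ →
0⁺ kills the difference. Positive σ suffice, so a one-sided computation can identify a two-sided
series. -/
lemma unique (hf : HasExpansion (𝓝[>] 0) f c) (hg : HasExpansion (𝓝[>] 0) f d) : c = d := by
  funext n
  induction n using Nat.strong_induction_on with
  | _ n ih =>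
    have h := (hg (n + 1)).sub (hf (n + 1))
    have h1 : (fun σ : ℝ => (c n - d n) * σ ^ n) =O[𝓝[>] 0] fun σ => σ ^ (n + 1) := by
      refine h.congr_left fun σ => ?_
      rw [Finset.sum_range_succ, Finset.sum_range_succ,
        Finset.sum_congr rfl fun k hk => show c k * σ ^ k = d k * σ ^ k by
          rw [ih k (Finset.mem_range.1 hk)]]
      ring
    obtain ⟨C, hC⟩ := h1.bound
    have h2 : ∀ᶠ σ : ℝ in 𝓝[>] 0, |c n - d n| ≤ C * σ := by
      filter_upwards [hC, self_mem_nhdsWithin] with σ hσ (h0 : 0 < σ)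
      rw [norm_mul, norm_pow, norm_pow, Real.norm_eq_abs, Real.norm_of_nonneg h0.le, pow_succ] at hσ
      have : 0 < σ ^ n := by positivity
      exact le_of_mul_le_mul_right (by linarith) this
    have h3 : Tendsto (fun σ : ℝ => C * σ) (𝓝[>] 0) (𝓝 0) := by
      have : Tendsto (fun σ : ℝ => C * σ) (𝓝 0) (𝓝 (C * 0)) := by
        exact (continuous_const.mul continuous_id).tendsto 0
      rw [mul_zero] at this
      exact this.mono_left nhdsWithin_le_nhds
    have h4 := ge_of_tendsto h3 h2
    exact sub_eq_zero.1 (abs_nonpos_iff.1 h4)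

lemma of_contDiffOn {ε : ℝ} (hε : 0 < ε) (hf : ContDiffOn ℝ ∞ f (Ioo (-ε) ε)) :
    HasExpansion (𝓝 0) f (fun k => iteratedDeriv k f 0 / k.factorial) := fun n => by
  have h0 : (0 : ℝ) ∈ Ioo (-ε) ε := by simp [hε]
  have h1 := taylor_isLittleO (convex_Ioo _ _) h0 (hf.of_le (mod_cast le_top : (n : WithTop ℕ∞) ≤ ∞))
  rw [isOpen_Ioo.nhdsWithin_eq h0] at h1
  -- Taylor's theorem of order n subtracts one term more than `HasExpansion` does at n; that extra
  -- term is itself O(σ^n).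
  have h2 : (fun σ : ℝ => iteratedDeriv n f 0 / n.factorial * σ ^ n) =O[𝓝 0] fun σ => σ ^ n :=
    (isBigO_refl _ _).const_mul_left _
  simp only [sub_zero] at h1
  refine (h1.isBigO.add h2).congr_left fun σ => ?_
  rw [taylor_within_apply, Finset.sum_range_succ]
  simp only [iteratedDerivWithin_of_isOpen isOpen_Ioo h0, sub_zero, smul_eq_mul]
  rw [Finset.sum_congr rfl fun k _ => show ((k.factorial : ℝ)⁻¹ * σ ^ k) * iteratedDeriv k f 0 =
    iteratedDeriv k f 0 / k.factorial * σ ^ k by ring]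
  ring

end HasExpansion

/-! ### Expansion of exponential integrals under the integral sign -/

section exponential_integral

variable {α : Type*} [MeasurableSpace α] {μ : Measure α} {F ℓ : α → ℝ} {δ : ℝ}

lemma pow_abs_le_factorial_mul_exp (hδ : 0 < δ) (x : ℝ) (k : ℕ) :
    |x| ^ k ≤ k.factorial / δ ^ k * Real.exp (δ * |x|) := by
  have h := Real.pow_div_factorial_le_exp (δ * |x|) (by positivity) k
  rw [mul_pow, div_le_iff₀ (by positivity)] at h
  rw [div_mul_eq_mul_div, le_div_iff₀ (by positivity)]
  linarith

lemma exp_mul_abs_le (δ x : ℝ) :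
    Real.exp (δ * |x|) ≤ Real.exp (δ * x) + Real.exp (-δ * x) := by
  rcases abs_choice x with h | h <;> rw [h]
  · linarith [Real.exp_pos (-δ * x)]
  · rw [mul_neg, ← neg_mul]
    linarith [Real.exp_pos (δ * x)]

/-- This is the common majorant: it dominates |F| |ℓ|^k up to a constant, and |F| e^{σℓ} for every
|σ| ≤ δ. -/
lemma integrable_mul_exp_abs
    (h1 : Integrable (fun a => F a * Real.exp (δ * ℓ a)) μ)
    (h2 : Integrable (fun a => F a * Real.exp (-δ * ℓ a)) μ) :
    Integrable (fun a => |F a| * (Real.exp (δ * ℓ a) + Real.exp (-δ * ℓ a))) μ := by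
  refine (h1.norm.add h2.norm).congr (Eventually.of_forall fun a => ?_)
  simp only [Pi.add_apply, norm_mul, Real.norm_eq_abs, Real.abs_exp]
  ring

lemma aestronglyMeasurable_of_mul_exp (hℓ : Measurable ℓ)
    (h1 : Integrable (fun a => F a * Real.exp (δ * ℓ a)) μ) : AEStronglyMeasurable F μ := by
  refine (h1.aestronglyMeasurable.mul
    (g := fun a => Real.exp (-(δ * ℓ a))) (by fun_prop)).congr (Eventually.of_forall fun a => ?_)
  simp only [Pi.mul_apply, mul_assoc]
  rw [← Real.exp_add]
  simp

lemma integrable_mul_pow_of_integrable_mul_exp (hδ : 0 < δ) (hℓ : Measurable ℓ)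
    (h1 : Integrable (fun a => F a * Real.exp (δ * ℓ a)) μ)
    (h2 : Integrable (fun a => F a * Real.exp (-δ * ℓ a)) μ) (k : ℕ) :
    Integrable (fun a => F a * ℓ a ^ k) μ := by
  refine ((integrable_mul_exp_abs h1 h2).const_mul (k.factorial / δ ^ k)).mono'
    ((aestronglyMeasurable_of_mul_exp hℓ h1).mul (by fun_prop)) (Eventually.of_forall fun a => ?_)
  rw [norm_mul, norm_pow, Real.norm_eq_abs, Real.norm_eq_abs]
  calc |F a| * |ℓ a| ^ k
      ≤ |F a| * (k.factorial / δ ^ k * (Real.exp (δ * ℓ a) + Real.exp (-δ * ℓ a))) := by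
        have := pow_abs_le_factorial_mul_exp hδ (ℓ a) k
        have h3 := exp_mul_abs_le δ (ℓ a)
        gcongr
        exact this.trans (by gcongr)
    _ = _ := by ring

lemma integrable_mul_exp_of_abs_le (hℓ : Measurable ℓ)
    (h1 : Integrable (fun a => F a * Real.exp (δ * ℓ a)) μ)
    (h2 : Integrable (fun a => F a * Real.exp (-δ * ℓ a)) μ) {σ : ℝ} (hσ : |σ| ≤ δ) :
    Integrable (fun a => F a * Real.exp (σ * ℓ a)) μ := by
  refine (integrable_mul_exp_abs h1 h2).mono'
    ((aestronglyMeasurable_of_mul_exp hℓ h1).mul (by fun_prop)) (Eventually.of_forall fun a => ?_)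
  rw [norm_mul, Real.norm_eq_abs, Real.norm_eq_abs, Real.abs_exp]
  gcongr
  refine le_trans ?_ (exp_mul_abs_le δ (ℓ a))
  refine Real.exp_le_exp.2 ((le_abs_self _).trans ?_)
  rw [abs_mul]
  gcongr

lemma norm_exp_sub_sum_le (x : ℝ) (n : ℕ) :
    |Real.exp x - ∑ m ∈ Finset.range n, x ^ m / m.factorial| ≤ |x| ^ n * Real.exp |x| := by
  have h := Complex.norm_exp_sub_sum_le_norm_mul_exp (x : ℂ) n
  rw [Complex.norm_real, Real.norm_eq_abs] at h
  rw [← Real.norm_eq_abs, ← Complex.norm_real]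
  push_cast
  exact h

/-- The exponential integral `σ ↦ ∫ F e^{σ ℓ}` may be expanded under the integral sign. -/
lemma hasExpansion_integral_mul_exp (hδ : 0 < δ) (hℓ : Measurable ℓ)
    (h1 : Integrable (fun a => F a * Real.exp (δ * ℓ a)) μ)
    (h2 : Integrable (fun a => F a * Real.exp (-δ * ℓ a)) μ) :
    HasExpansion (𝓝 0) (fun σ => ∫ a, F a * Real.exp (σ * ℓ a) ∂μ)
      (fun k => (∫ a, F a * ℓ a ^ k ∂μ) / k.factorial) := fun n => by
  set G := fun a => |F a| * (Real.exp (δ * ℓ a) + Real.exp (-δ * ℓ a))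
  have hG : Integrable G μ := integrable_mul_exp_abs h1 h2
  refine IsBigO.of_bound (n.factorial / (δ / 2) ^ n * ∫ a, G a ∂μ) ?_
  -- Only half of the exponent δ is spent on the factor e^{|σℓ|} of the remainder; the other half
  -- absorbs |ℓ|^n.
  filter_upwards [Metric.closedBall_mem_nhds (0 : ℝ) (half_pos hδ)] with σ hσ
  rw [mem_closedBall_zero_iff, Real.norm_eq_abs] at hσ
  have hi := integrable_mul_pow_of_integrable_mul_exp hδ hℓ h1 h2
  have he := integrable_mul_exp_of_abs_le hℓ h1 h2 (hσ.trans (by linarith))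
  have h3 : (∫ a, F a * Real.exp (σ * ℓ a) ∂μ) -
      ∑ k ∈ Finset.range n, (∫ a, F a * ℓ a ^ k ∂μ) / k.factorial * σ ^ k =
      ∫ a, F a * (Real.exp (σ * ℓ a) - ∑ k ∈ Finset.range n, (σ * ℓ a) ^ k / k.factorial) ∂μ := by
    have h4 : ∀ k, (∫ a, F a * ℓ a ^ k ∂μ) / k.factorial * σ ^ k =
        ∫ a, F a * ((σ * ℓ a) ^ k / k.factorial) ∂μ := fun k => by
      rw [div_mul_eq_mul_div, mul_div_assoc, ← integral_mul_const]
      congr 1 with a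
      ring
    simp only [h4, mul_sub, Finset.mul_sum]
    have h5 : ∀ k, Integrable (fun a => F a * ((σ * ℓ a) ^ k / k.factorial)) μ := fun k =>
      ((hi k).mul_const (σ ^ k / k.factorial)).congr (Eventually.of_forall fun a => by
        simp only; ring)
    rw [integral_sub he (integrable_finsetSum _ fun k _ => h5 k),
      integral_finsetSum _ fun k _ => h5 k]
  rw [h3]
  calc ‖∫ a, F a * (Real.exp (σ * ℓ a) - ∑ k ∈ Finset.range n, (σ * ℓ a) ^ k / k.factorial) ∂μ‖
      ≤ ∫ a, n.factorial / (δ / 2) ^ n * |σ| ^ n * G a ∂μ := by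
        refine norm_integral_le_of_norm_le (hG.const_mul _) (Eventually.of_forall fun a => ?_)
        rw [norm_mul, Real.norm_eq_abs, Real.norm_eq_abs]
        have h6 := norm_exp_sub_sum_le (σ * ℓ a) n
        have h7 := pow_abs_le_factorial_mul_exp (half_pos hδ) (ℓ a) n
        have h8 := exp_mul_abs_le δ (ℓ a)
        have h9 : Real.exp (|σ| * |ℓ a|) ≤ Real.exp (δ / 2 * |ℓ a|) := by gcongr
        have h10 : Real.exp (δ * |ℓ a|) = Real.exp (δ / 2 * |ℓ a|) * Real.exp (δ / 2 * |ℓ a|) := by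
          rw [← Real.exp_add]
          ring_nf
        rw [abs_mul, mul_pow] at h6
        calc |F a| * |Real.exp (σ * ℓ a) - ∑ k ∈ Finset.range n, (σ * ℓ a) ^ k / k.factorial|
            ≤ |F a| * (|σ| ^ n * |ℓ a| ^ n * Real.exp (|σ| * |ℓ a|)) := by gcongr
          _ ≤ |F a| * (|σ| ^ n * (n.factorial / (δ / 2) ^ n * Real.exp (δ / 2 * |ℓ a|)) *
              Real.exp (δ / 2 * |ℓ a|)) := by gcongr
          _ = n.factorial / (δ / 2) ^ n * |σ| ^ n * (|F a| * Real.exp (δ * |ℓ a|)) := by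
              rw [h10]; ring
          _ ≤ _ := by
              gcongr
              exact mul_le_mul_of_nonneg_left h8 (abs_nonneg _)
    _ = _ := by
        rw [integral_const_mul, norm_pow, Real.norm_eq_abs]
        ring

end exponential_integral

/-! ### Smoothness of κ₁ and κ₂ near 0 -/

section kappa

/-- The complex Gamma function is holomorphic on the right half-plane, hence smooth there, and
restricts to the real one. -/
lemma contDiffAt_Gamma {s : ℝ} (hs : 0 < s) : ContDiffAt ℝ ∞ Real.Gamma s := by
  have hU : IsOpen {z : ℂ | 0 < z.re} := isOpen_lt continuous_const Complex.continuous_re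
  have h : DifferentiableOn ℂ Complex.Gamma {z : ℂ | 0 < z.re} := fun z hz =>
    (Complex.differentiableAt_Gamma z fun m hm => by
      have hz' : 0 < z.re := hz
      rw [hm] at hz'
      simp at hz'
      linarith [Nat.cast_nonneg (α := ℝ) m]).differentiableWithinAt
  have h1 : ContDiffAt ℂ ∞ Complex.Gamma (s : ℂ) :=
    (h.contDiffOn hU).contDiffAt (hU.mem_nhds (by simpa using hs))
  have h2 := h1.real_of_complex
  refine h2.congr_of_eventuallyEq (Eventually.of_forall fun x => ?_)
  simp [Complex.Gamma_ofReal]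

lemma contDiffOn_gamma_ratio {N : ℕ} (hN : 1 ≤ N) :
    ContDiffOn ℝ ∞ (fun s => (2 : ℝ) ^ (-2 * s) *
      (Real.Gamma (((N : ℝ) - 2 * s) / 2) / Real.Gamma (1 + s))) (Ioo (-(1 / 2)) (1 / 2)) := by
  intro s hs
  have hN' : (1 : ℝ) ≤ N := by exact_mod_cast hN
  have h1 : ContDiffAt ℝ ∞ (fun s : ℝ => Real.Gamma (((N : ℝ) - 2 * s) / 2)) s :=
    (contDiffAt_Gamma (by linarith [hs.2])).comp s (by fun_prop)
  have h2 : ContDiffAt ℝ ∞ (fun s : ℝ => Real.Gamma (1 + s)) s :=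
    (contDiffAt_Gamma (by linarith [hs.1])).comp s (by fun_prop)
  have h3 : ContDiffAt ℝ ∞ (fun s : ℝ => (2 : ℝ) ^ (-2 * s)) s :=
    contDiffAt_const.rpow (contDiffAt_const.mul contDiffAt_id) two_ne_zero
  exact (h3.mul (h1.div h2
    (Real.Gamma_pos_of_pos (by linarith [hs.1])).ne')).contDiffWithinAt

lemma hasExpansion_kappa₁ {N : ℕ} (hN : 1 ≤ N) :
    HasExpansion (𝓝 0) (kappa₁ N) (fun k => iteratedDeriv k (kappa₁ N) 0 / k.factorial) :=
  HasExpansion.of_contDiffOn one_half_pos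
    (((contDiffOn_gamma_ratio hN).mul (contDiffOn_const (c := π ^ (-(N : ℝ) / 2)))).congr
      fun s _ => by simp only [kappa₁]; ring)

lemma hasExpansion_kappa₂ {N : ℕ} (hN : 1 ≤ N) :
    HasExpansion (𝓝 0) (kappa₂ N) (fun k => iteratedDeriv k (kappa₂ N) 0 / k.factorial) :=
  HasExpansion.of_contDiffOn one_half_pos
    (((contDiffOn_gamma_ratio hN).mul (contDiffOn_const (c := (Real.Gamma (N / 2))⁻¹))).congr
      fun s _ => by simp only [kappa₂]; ring)

end kappa

/-! ### Radial integrals of powers of the norm -/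

section radial

variable {N : ℕ}

lemma finrank_sp : Module.finrank ℝ (Sp N) = N := by simp

lemma nontrivial_sp (hN : 1 ≤ N) : Nontrivial (Sp N) :=
  Module.nontrivial_of_finrank_pos (R := ℝ) (by rw [finrank_sp]; omega)

lemma integrableOn_ball_norm_rpow (hN : 1 ≤ N) {a : ℝ} (ha : -(N : ℝ) < a) (r : ℝ) :
    IntegrableOn (fun z : Sp N => ‖z‖ ^ a) (Metric.ball 0 r) := by
  refine integrableOn_ball_of_norm_le_rpow (C := 1) (α := -a) (by rwa [finrank_sp])
    (by rw [finrank_sp]; linarith) (Eventually.of_forall fun z => ?_)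
    (by fun_prop : Measurable fun z : Sp N => ‖z‖ ^ a).aestronglyMeasurable
  rw [neg_neg, one_mul, Real.norm_of_nonneg (by positivity)]

lemma integrableOn_compl_ball_norm_rpow {a : ℝ} (ha : a < -(N : ℝ)) {r : ℝ} (hr : 0 < r) :
    IntegrableOn (fun z : Sp N => ‖z‖ ^ a) (Metric.ball 0 r)ᶜ := by
  -- Outside the ball of radius r one has 1 + ‖z‖ ≤ (1/r + 1)‖z‖, which explains the constant.
  have h := (integrable_one_add_norm (E := Sp N) (μ := volume) (r := -a)
    (by rw [finrank_sp]; linarith)).const_mul ((1 / r + 1) ^ (-a))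
  refine h.integrableOn.mono'
    (by fun_prop : Measurable fun z : Sp N => ‖z‖ ^ a).aestronglyMeasurable ?_
  refine (ae_restrict_iff' Metric.isOpen_ball.measurableSet.compl).2 (Eventually.of_forall fun z hz => ?_)
  have hz' : r ≤ ‖z‖ := by simpa using hz
  have hz0 : 0 < ‖z‖ := hr.trans_le hz'
  have h1 : 1 + ‖z‖ ≤ (1 / r + 1) * ‖z‖ := by
    have : 1 ≤ 1 / r * ‖z‖ := by rw [one_div, inv_mul_eq_div, le_div_iff₀ hr]; linarith
    linarith
  have hN0 : (0 : ℝ) ≤ N := Nat.cast_nonneg N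
  have h2 := Real.rpow_le_rpow_of_nonpos (by positivity : 0 < 1 + ‖z‖) h1 (by linarith : a ≤ 0)
  rw [neg_neg, Real.norm_of_nonneg (by positivity)]
  rw [Real.mul_rpow (by positivity) (by positivity)] at h2
  calc ‖z‖ ^ a = (1 / r + 1) ^ (-a) * ((1 / r + 1) ^ a * ‖z‖ ^ a) := by
        rw [← mul_assoc, ← Real.rpow_add (by positivity)]; simp
    _ ≤ _ := by gcongr

/-- In polar coordinates the integral is N |B_1| ∫_1^∞ t^{-1-2σ} dt. Its product with `fracConst` is
κ₂(-σ), the source of the zeroth-order coefficient of 𝓛_m. -/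
lemma integral_compl_ball_norm_rpow (hN : 1 ≤ N) {σ : ℝ} (hσ : 0 < σ) :
    ∫ z in (Metric.ball (0 : Sp N) 1)ᶜ, ‖z‖ ^ (-((N : ℝ) + 2 * σ)) =
      π ^ ((N : ℝ) / 2) / (Real.Gamma (N / 2) * σ) := by
  have := nontrivial_sp hN
  have hN' : (0 : ℝ) < N := by exact_mod_cast hN
  have h1 := integral_fun_norm_addHaar (volume : Measure (Sp N))
    ((Ici (1 : ℝ)).indicator fun t => t ^ (-((N : ℝ) + 2 * σ)))
  rw [← integral_indicator Metric.isOpen_ball.measurableSet.compl]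
  have h2 : (Metric.ball (0 : Sp N) 1)ᶜ.indicator (fun z => ‖z‖ ^ (-((N : ℝ) + 2 * σ))) =
      fun z => (Ici (1 : ℝ)).indicator (fun t => t ^ (-((N : ℝ) + 2 * σ))) ‖z‖ := by
    funext z
    simp [indicator]
  have h3 : ∫ y in Ioi (0 : ℝ), y ^ (Module.finrank ℝ (Sp N) - 1) •
      (Ici (1 : ℝ)).indicator (fun t => t ^ (-((N : ℝ) + 2 * σ))) y = 1 / (2 * σ) := by
    have h4 : ∀ y : ℝ, y ^ (Module.finrank ℝ (Sp N) - 1) •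
      (Ici (1 : ℝ)).indicator (fun t => t ^ (-((N : ℝ) + 2 * σ))) y =
      (Ici (1 : ℝ)).indicator (fun t => t ^ (-1 - 2 * σ)) y := fun y => by
      by_cases hy : y ∈ Ici (1 : ℝ)
      · have hy0 : 0 < y := one_pos.trans_le hy
        rw [indicator_of_mem hy, indicator_of_mem hy, finrank_sp, smul_eq_mul, ← Real.rpow_natCast,
          ← Real.rpow_add hy0, Nat.cast_sub hN]
        congr 1
        push_cast
        ring
      · rw [indicator_of_notMem hy, indicator_of_notMem hy, smul_zero]
    simp only [h4]
    rw [setIntegral_indicator measurableSet_Ici, inter_eq_right.2 (Ici_subset_Ioi.2 one_pos),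
      integral_Ici_eq_integral_Ioi, integral_Ioi_rpow_of_lt (by linarith) one_pos, Real.one_rpow]
    rw [show -1 - 2 * σ + 1 = -(2 * σ) by ring, neg_div_neg_eq]
  have h5 : (volume : Measure (Sp N)).real (Metric.ball 0 1) =
      π ^ ((N : ℝ) / 2) / Real.Gamma (N / 2 + 1) := by
    have : Nonempty (Fin N) := Fin.pos_iff_nonempty.mp hN
    rw [Measure.real, EuclideanSpace.volume_ball]
    simp only [ENNReal.ofReal_one, one_pow, one_mul, Fintype.card_fin]
    rw [ENNReal.toReal_ofReal (by positivity), Real.sqrt_eq_rpow, ← Real.rpow_natCast,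
      ← Real.rpow_mul pi_pos.le]
    congr 2
    ring
  rw [h2, h1, h3, h5, finrank_sp, Real.Gamma_add_one (by positivity)]
  have := Real.Gamma_pos_of_pos (show (0 : ℝ) < N / 2 by positivity)
  simp only [nsmul_eq_mul, smul_eq_mul]
  field_simp

end radial

/-! ### Powers as superpositions of exponentials -/

section subordination

lemma integrableOn_rpow_mul_exp_neg_mul {a r : ℝ} (ha : 0 < a) (hr : 0 < r) :
    IntegrableOn (fun τ : ℝ => τ ^ (a - 1) * Real.exp (-(r * τ))) (Ioi 0) := by
  by_contra h
  have h1 := Real.integral_rpow_mul_exp_neg_mul_Ioi ha hr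
  -- A non-integrable function has integral 0 by convention, whereas the Gamma formula gives a
  -- positive value.
  rw [integral_undef h] at h1
  have := Real.Gamma_pos_of_pos ha
  have : 0 < (1 / r) ^ a * Real.Gamma a := by positivity
  linarith

/-- The Gamma integral under the substitution τ ↦ 1/τ. -/
lemma integral_rpow_mul_exp_neg_div {a b : ℝ} (ha : 0 < a) (hb : 0 < b) :
    ∫ τ in Ioi (0 : ℝ), τ ^ (-a - 1) * Real.exp (-(b / τ)) = b ^ (-a) * Real.Gamma a := by
  have h := integral_comp_rpow_Ioi (fun y : ℝ => y ^ (a - 1) * Real.exp (-(b * y)))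
    (p := -1) (by norm_num)
  rw [Real.integral_rpow_mul_exp_neg_mul_Ioi ha hb, one_div, Real.inv_rpow hb.le,
    ← Real.rpow_neg hb.le] at h
  rw [← h]
  refine setIntegral_congr_fun measurableSet_Ioi fun τ hτ => ?_
  have hτ0 : 0 < τ := hτ
  simp only [smul_eq_mul, abs_neg, abs_one, one_mul, Real.rpow_neg_one]
  rw [Real.inv_rpow hτ0.le, ← Real.rpow_neg hτ0.le, ← mul_assoc, ← Real.rpow_add hτ0]
  congr 2
  ring

lemma integrableOn_rpow_mul_exp_neg_div {a b : ℝ} (ha : 0 < a) (hb : 0 < b) :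
    IntegrableOn (fun τ : ℝ => τ ^ (-a - 1) * Real.exp (-(b / τ))) (Ioi 0) := by
  by_contra h
  have h1 := integral_rpow_mul_exp_neg_div ha hb
  rw [integral_undef h] at h1
  have := Real.Gamma_pos_of_pos ha
  have : 0 < b ^ (-a) * Real.Gamma a := by positivity
  linarith

lemma one_sub_exp_neg_mem {b : ℝ} (hb : 0 ≤ b) :
    0 ≤ 1 - Real.exp (-b) ∧ 1 - Real.exp (-b) ≤ 1 ∧ 1 - Real.exp (-b) ≤ b := by
  have h1 : Real.exp (-b) ≤ 1 := Real.exp_le_one_iff.2 (by linarith)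
  have h2 := Real.exp_pos (-b)
  have h3 := Real.add_one_le_exp (-b)
  exact ⟨by linarith, by linarith, by linarith⟩

lemma integrableOn_rpow_mul_one_sub_exp {σ b : ℝ} (h0 : 0 < σ) (h1 : σ < 1) (hb : 0 ≤ b) :
    IntegrableOn (fun τ : ℝ => τ ^ (σ - 1) * (1 - Real.exp (-(b / τ)))) (Ioi 0) := by
  have hm : Measurable fun τ : ℝ => τ ^ (σ - 1) * (1 - Real.exp (-(b / τ))) := by fun_prop
  rw [← Ioc_union_Ioi_eq_Ioi (zero_le_one' ℝ)]
  refine IntegrableOn.union ?_ ?_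
  · have h : IntegrableOn (fun τ : ℝ => τ ^ (σ - 1)) (Ioc 0 1) := by
      rw [← intervalIntegrable_iff_integrableOn_Ioc_of_le zero_le_one]
      exact intervalIntegral.intervalIntegrable_rpow' (by linarith)
    refine h.mono' hm.aestronglyMeasurable ((ae_restrict_iff' measurableSet_Ioc).2
      (Eventually.of_forall fun τ hτ => ?_))
    have hτ0 : 0 < τ := hτ.1
    obtain ⟨h2, h3, -⟩ := one_sub_exp_neg_mem (show 0 ≤ b / τ by positivity)
    rw [Real.norm_of_nonneg (by positivity)]
    exact mul_le_of_le_one_right (by positivity) h3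
  · have h : IntegrableOn (fun τ : ℝ => τ ^ (σ - 2) * b) (Ioi 1) :=
      (integrableOn_Ioi_rpow_of_lt (by linarith) one_pos).mul_const b
    refine h.mono' hm.aestronglyMeasurable ((ae_restrict_iff' measurableSet_Ioi).2
      (Eventually.of_forall fun τ hτ => ?_))
    have hτ0 : 0 < τ := one_pos.trans hτ
    obtain ⟨h2, -, h3⟩ := one_sub_exp_neg_mem (show 0 ≤ b / τ by positivity)
    rw [Real.norm_of_nonneg (by positivity)]
    calc τ ^ (σ - 1) * (1 - Real.exp (-(b / τ))) ≤ τ ^ (σ - 1) * (b / τ) := by gcongr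
      _ = _ := by
        rw [show σ - 1 = σ - 2 + 1 by ring, Real.rpow_add_one hτ0.ne']
        field_simp

/-- Integration by parts reduces this to `integral_rpow_mul_exp_neg_div` with a = 1 - σ. -/
lemma integral_rpow_mul_one_sub_exp {σ b : ℝ} (h0 : 0 < σ) (h1 : σ < 1) (hb : 0 < b) :
    ∫ τ in Ioi (0 : ℝ), τ ^ (σ - 1) * (1 - Real.exp (-(b / τ))) =
      b ^ σ * Real.Gamma (1 - σ) / σ := by
  have hi1 := integrableOn_rpow_mul_one_sub_exp h0 h1 hb.le
  have hi2 := (integrableOn_rpow_mul_exp_neg_div (a := 1 - σ) (by linarith) hb).const_mul (b / σ)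
  -- The boundary term of the integration by parts: it is at most τ^σ/σ near 0 and at most
  -- bτ^{σ-1}/σ at infinity, so it vanishes at both ends when 0 < σ < 1.
  set G : ℝ → ℝ := fun τ => τ ^ σ / σ * (1 - Real.exp (-(b / τ))) with hG
  have hd : ∀ τ ∈ Ioi (0 : ℝ), HasDerivAt G (τ ^ (σ - 1) * (1 - Real.exp (-(b / τ))) -
      b / σ * (τ ^ (-(1 - σ) - 1) * Real.exp (-(b / τ)))) τ := fun τ hτ => by
    have hτ0 : 0 < τ := hτ
    have e1 := (Real.hasDerivAt_rpow_const (p := σ) (Or.inl hτ0.ne')).div_const σ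
    have e2 : HasDerivAt (fun τ : ℝ => 1 - Real.exp (-(b / τ)))
        (-(Real.exp (-(b / τ)) * (b / τ ^ 2))) τ := by
      have e3 := ((hasDerivAt_inv hτ0.ne').const_mul b).neg.exp.const_sub 1
      refine (e3.congr_deriv ?_).congr_of_eventuallyEq (Eventually.of_forall fun x => ?_)
      · simp only [div_eq_mul_inv, Pi.neg_apply]; ring
      · simp only [div_eq_mul_inv, Pi.neg_apply]
    refine (e1.mul e2).congr_deriv ?_
    have e4 : τ ^ σ = τ ^ (-(1 - σ) - 1) * τ ^ 2 := by
      rw [← Real.rpow_natCast, ← Real.rpow_add hτ0]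
      congr 1
      push_cast
      ring
    rw [e4]
    field_simp
    ring
  have hbd : ∀ τ ∈ Ioi (0 : ℝ), 0 ≤ G τ ∧ G τ ≤ τ ^ σ / σ ∧ G τ ≤ b / σ * τ ^ (-(1 - σ)) :=
    fun τ hτ => by
    have hτ0 : 0 < τ := hτ
    obtain ⟨h2, h3, h4⟩ := one_sub_exp_neg_mem (show 0 ≤ b / τ by positivity)
    refine ⟨by positivity, mul_le_of_le_one_right (by positivity) h3, ?_⟩
    calc G τ ≤ τ ^ σ / σ * (b / τ) := by simp only [hG]; gcongr
      _ = _ := by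
        rw [show -(1 - σ) = σ - 1 by ring, Real.rpow_sub_one hτ0.ne']
        field_simp
  have hc : ContinuousWithinAt G (Ici 0) 0 := by
    have hG0 : G 0 = 0 := by simp [hG]
    rw [ContinuousWithinAt, hG0]
    have ht : Tendsto (fun τ : ℝ => τ ^ σ / σ) (𝓝[≥] 0) (𝓝 0) := by
      have : ContinuousAt (fun τ : ℝ => τ ^ σ / σ) 0 :=
        (Real.continuousAt_rpow_const _ _ (Or.inr h0.le)).div_const σ
      have h := this.tendsto
      simp only [Real.zero_rpow h0.ne', zero_div] at h
      exact h.mono_left nhdsWithin_le_nhds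
    refine tendsto_of_tendsto_of_tendsto_of_le_of_le' tendsto_const_nhds ht ?_ ?_
    all_goals
      filter_upwards [self_mem_nhdsWithin] with τ hτ
      rcases eq_or_lt_of_le (show (0 : ℝ) ≤ τ from hτ) with rfl | h
      · rw [hG0]
        try rw [Real.zero_rpow h0.ne', zero_div]
      · first | exact (hbd τ h).1 | exact (hbd τ h).2.1
  have htop : Tendsto G atTop (𝓝 0) := by
    have ht := (tendsto_rpow_neg_atTop (show 0 < 1 - σ by linarith)).const_mul (b / σ)
    rw [mul_zero] at ht
    refine tendsto_of_tendsto_of_tendsto_of_le_of_le' tendsto_const_nhds ht ?_ ?_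
    · filter_upwards [Ioi_mem_atTop (0 : ℝ)] with τ hτ using (hbd τ hτ).1
    · filter_upwards [Ioi_mem_atTop (0 : ℝ)] with τ hτ using (hbd τ hτ).2.2
  have h := integral_Ioi_of_hasDerivAt_of_tendsto hc hd (hi1.sub hi2) htop
  rw [integral_sub hi1 hi2, integral_const_mul,
    integral_rpow_mul_exp_neg_div (by linarith) hb] at h
  simp only [hG, Real.zero_rpow h0.ne', zero_div, zero_mul, sub_zero] at h
  rw [sub_eq_zero.1 h, neg_sub, Real.rpow_sub_one hb.ne']
  field_simp

/-- Fubini's theorem for a weight that is a superposition of nonnegative kernels. -/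
lemma integral_mul_integral_Ioi_swap {α : Type*} [MeasurableSpace α] {μ : Measure α} [SFinite μ]
    {g : α → ℂ} {k : α → ℝ → ℝ} (hk : Measurable (Function.uncurry k))
    (hk0 : ∀ a, ∀ τ ∈ Ioi (0 : ℝ), 0 ≤ k a τ)
    (hki : ∀ᵐ a ∂μ, IntegrableOn (k a) (Ioi 0)) (hg : AEStronglyMeasurable g μ)
    (hgi : Integrable (fun a => g a * ((∫ τ in Ioi (0 : ℝ), k a τ : ℝ) : ℂ)) μ) :
    ∫ a, g a * ((∫ τ in Ioi (0 : ℝ), k a τ : ℝ) : ℂ) ∂μ =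
      ∫ τ in Ioi (0 : ℝ), ∫ a, g a * (k a τ : ℂ) ∂μ := by
  have hint : Integrable (Function.uncurry fun a τ => g a * (k a τ : ℂ))
      (μ.prod (volume.restrict (Ioi (0 : ℝ)))) := by
    have hm : AEStronglyMeasurable (Function.uncurry fun a τ => g a * (k a τ : ℂ))
        (μ.prod (volume.restrict (Ioi (0 : ℝ)))) :=
      (hg.comp_fst).mul (Complex.measurable_ofReal.comp hk).aestronglyMeasurable
    refine (integrable_prod_iff hm).2 ⟨?_, ?_⟩
    · filter_upwards [hki] with a ha
      exact ha.ofReal.const_mul (g a)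
    · refine hgi.norm.congr (Eventually.of_forall fun a => ?_)
      have h0 : 0 ≤ ∫ τ in Ioi (0 : ℝ), k a τ := setIntegral_nonneg measurableSet_Ioi (hk0 a)
      simp only [Function.uncurry, norm_mul, Complex.norm_real]
      rw [integral_const_mul, Real.norm_of_nonneg h0]
      congr 1
      exact setIntegral_congr_fun measurableSet_Ioi fun τ hτ => by
        simp only [Real.norm_of_nonneg (hk0 a τ hτ)]
  rw [← integral_integral_swap hint]
  refine integral_congr_ae (Eventually.of_forall fun a => ?_)
  simp only
  rw [integral_const_mul, integral_complex_ofReal]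

end subordination

/-! ### Plane waves and Gaussians -/

section planeWave

variable {N : ℕ}

/-- The plane wave `e^{2πi⟨ξ, x⟩}`. -/
noncomputable def planeWave (x ξ : Sp N) : ℂ := Complex.exp ((2 * π * inner ℝ ξ x : ℝ) * Complex.I)

lemma norm_planeWave (x ξ : Sp N) : ‖planeWave x ξ‖ = 1 := Complex.norm_exp_ofReal_mul_I _

lemma continuous_planeWave : Continuous (Function.uncurry (planeWave (N := N))) := by
  unfold planeWave Function.uncurry
  fun_prop

lemma continuous_planeWave_right (x : Sp N) : Continuous (planeWave x) := by
  unfold planeWave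
  fun_prop

lemma continuous_planeWave_left (ξ : Sp N) : Continuous (fun x => planeWave x ξ) := by
  unfold planeWave
  fun_prop

lemma planeWave_add (x y ξ : Sp N) : planeWave (x + y) ξ = planeWave x ξ * planeWave y ξ := by
  simp only [planeWave]
  rw [← Complex.exp_add, inner_add_right]
  congr 1
  push_cast
  ring

lemma planeWave_sub (x y ξ : Sp N) : planeWave (x - y) ξ = planeWave x ξ * planeWave (-y) ξ := by
  rw [sub_eq_add_neg, planeWave_add]

lemma planeWave_re (x ξ : Sp N) : (planeWave x ξ).re = Real.cos (2 * π * inner ℝ ξ x) := by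
  simp only [planeWave, Complex.exp_ofReal_mul_I_re]

lemma planeWave_add_neg (x ξ : Sp N) :
    planeWave x ξ + planeWave (-x) ξ = ((2 * Real.cos (2 * π * inner ℝ ξ x) : ℝ) : ℂ) := by
  simp only [planeWave, inner_neg_right, mul_neg]
  push_cast
  rw [Complex.two_cos, neg_mul]

lemma norm_planeWave_sub_le (x y ξ : Sp N) :
    ‖planeWave x ξ - planeWave y ξ‖ ≤ 2 * π * ‖ξ‖ * ‖x - y‖ := by
  have h : planeWave x ξ - planeWave y ξ = planeWave y ξ * (planeWave (x - y) ξ - 1) := by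
    rw [mul_sub, ← planeWave_add]
    simp
  rw [h, norm_mul, norm_planeWave, one_mul]
  simp only [planeWave]
  rw [mul_comm _ Complex.I]
  refine (Real.norm_exp_I_mul_ofReal_sub_one_le).trans ?_
  rw [Real.norm_eq_abs, abs_mul, abs_of_pos (by positivity), mul_assoc (2 * π)]
  gcongr
  exact abs_real_inner_le_norm _ _

lemma integrable_planeWave_mul {f : Sp N → ℂ} (hf : Integrable f) (x : Sp N) :
    Integrable (fun ξ => planeWave x ξ * f ξ) :=
  hf.bdd_mul (c := 1) (continuous_planeWave_right x).aestronglyMeasurable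
    (Eventually.of_forall fun ξ => (norm_planeWave x ξ).le)

lemma integral_planeWave_mul_gaussian (ξ : Sp N) {τ : ℝ} (hτ : 0 < τ) :
    ∫ z : Sp N, planeWave z ξ * (Real.exp (-(‖z‖ ^ 2 * τ)) : ℂ) =
      (((π / τ) ^ ((N : ℝ) / 2) * Real.exp (-(π ^ 2 * ‖ξ‖ ^ 2 / τ)) : ℝ) : ℂ) := by
  have h := GaussianFourier.integral_cexp_neg_mul_sq_norm_add (V := Sp N) (b := (τ : ℂ)) (by simpa)
    (2 * π * Complex.I) ξ
  rw [finrank_sp] at h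
  convert h using 1
  · refine integral_congr_ae (Eventually.of_forall fun z => ?_)
    simp only [planeWave]
    push_cast
    rw [← Complex.exp_add]
    congr 1
    ring
  · push_cast
    rw [Complex.ofReal_cpow (by positivity)]
    push_cast
    congr 2
    have : (τ : ℂ) ≠ 0 := by exact_mod_cast hτ.ne'
    rw [mul_pow, Complex.I_sq]
    field_simp
    ring

lemma integrable_gaussian {τ : ℝ} (hτ : 0 < τ) :
    Integrable (fun z : Sp N => Real.exp (-(‖z‖ ^ 2 * τ))) := by
  have h := GaussianFourier.integrable_cexp_neg_mul_sq_norm_add (V := Sp N) (b := (τ : ℂ)) (by simpa)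
    0 0
  refine h.norm.congr (Eventually.of_forall fun z => ?_)
  simp only [Complex.norm_exp]
  congr 1
  simp [← Complex.ofReal_pow]
  ring

/-- Fubini moves the Gaussian onto each plane wave, where its Fourier transform is explicit. All
later multiplier identities for the Riesz kernel are superpositions of this one over τ. -/
lemma integral_mul_gaussian_of_planeWave {f v : Sp N → ℂ} (hf : Integrable f)
    (hv : ∀ y, v y = ∫ ξ, planeWave y ξ * f ξ) (x : Sp N) {τ : ℝ} (hτ : 0 < τ) :
    ∫ z, v (x - z) * (Real.exp (-(‖z‖ ^ 2 * τ)) : ℂ) =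
      ∫ ξ, planeWave x ξ * f ξ *
        (((π / τ) ^ ((N : ℝ) / 2) * Real.exp (-(π ^ 2 * ‖ξ‖ ^ 2 / τ)) : ℝ) : ℂ) := by
  have hint : Integrable (Function.uncurry fun z ξ : Sp N =>
      planeWave (x - z) ξ * ((Real.exp (-(‖z‖ ^ 2 * τ)) : ℂ) * f ξ)) (volume.prod volume) := by
    refine ((integrable_gaussian hτ).ofReal.mul_prod hf).bdd_mul (c := 1) ?_
      (Eventually.of_forall fun p => (norm_planeWave _ _).le)
    exact (continuous_planeWave.comp (f := fun p : Sp N × Sp N => (x - p.1, p.2))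
      (by fun_prop)).aestronglyMeasurable
  calc ∫ z, v (x - z) * (Real.exp (-(‖z‖ ^ 2 * τ)) : ℂ)
      = ∫ z, ∫ ξ, planeWave (x - z) ξ * ((Real.exp (-(‖z‖ ^ 2 * τ)) : ℂ) * f ξ) := by
        refine integral_congr_ae (Eventually.of_forall fun z => ?_)
        simp only
        rw [hv, ← integral_mul_const]
        refine integral_congr_ae (Eventually.of_forall fun ξ => ?_)
        simp only
        ring
    _ = ∫ ξ, ∫ z, planeWave (x - z) ξ * ((Real.exp (-(‖z‖ ^ 2 * τ)) : ℂ) * f ξ) :=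
        integral_integral_swap hint
    _ = _ := by
        refine integral_congr_ae (Eventually.of_forall fun ξ => ?_)
        simp only
        rw [← integral_planeWave_mul_gaussian ξ hτ, ← integral_const_mul,
          ← integral_neg_eq_self]
        refine integral_congr_ae (Eventually.of_forall fun z => ?_)
        simp only [norm_neg, sub_neg_eq_add, planeWave_add]
        ring

end planeWave

/-! ### Homogeneous kernels and the constant of the fractional Laplacian -/

section kernels

variable {N : ℕ}

lemma ae_ne_zero (hN : 1 ≤ N) : ∀ᵐ z : Sp N, z ≠ 0 := by
  have := nontrivial_sp hN
  simp [ae_iff]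

lemma measurable_gaussian_weight (a : ℝ) :
    Measurable (Function.uncurry fun (z : Sp N) (τ : ℝ) =>
      τ ^ (a - 1) * Real.exp (-(‖z‖ ^ 2 * τ))) := by
  unfold Function.uncurry
  fun_prop

lemma integral_gaussian_weight {a : ℝ} (ha : 0 < a) {z : Sp N} (hz : z ≠ 0) :
    ∫ τ in Ioi (0 : ℝ), τ ^ (a - 1) * Real.exp (-(‖z‖ ^ 2 * τ)) =
      Real.Gamma a * ‖z‖ ^ (-(2 * a)) := by
  have hz' : 0 < ‖z‖ := norm_pos_iff.2 hz
  rw [Real.integral_rpow_mul_exp_neg_mul_Ioi ha (by positivity), one_div, Real.inv_rpow (by positivity),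
    ← Real.rpow_natCast, ← Real.rpow_mul hz'.le, ← Real.rpow_neg hz'.le, mul_comm]
  norm_num

/-- The identity Γ(a)|z|^{-2a} = ∫_0^∞ τ^{a-1} e^{-|z|²τ} dτ is inserted and the integrals are
exchanged, so that homogeneous kernels need only be tested on Gaussians. -/
lemma Gamma_mul_integral_mul_rpow (hN : 1 ≤ N) {a : ℝ} (ha : 0 < a) {g : Sp N → ℂ}
    (hg : AEStronglyMeasurable g)
    (hgi : Integrable (fun z => g z * ((‖z‖ ^ (-(2 * a)) : ℝ) : ℂ))) :
    Real.Gamma a * ∫ z, g z * ((‖z‖ ^ (-(2 * a)) : ℝ) : ℂ) =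
      ∫ τ in Ioi (0 : ℝ), ((τ ^ (a - 1) : ℝ) : ℂ) * ∫ z, g z * (Real.exp (-(‖z‖ ^ 2 * τ)) : ℂ) := by
  have h0 : (fun z => g z * ((∫ τ in Ioi (0 : ℝ), τ ^ (a - 1) * Real.exp (-(‖z‖ ^ 2 * τ)) : ℝ) : ℂ))
      =ᵐ[volume] fun z => Real.Gamma a * (g z * ((‖z‖ ^ (-(2 * a)) : ℝ) : ℂ)) := by
    filter_upwards [ae_ne_zero hN] with z hz
    rw [integral_gaussian_weight ha hz]
    push_cast
    ring
  rw [← integral_const_mul, ← integral_congr_ae h0,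
    integral_mul_integral_Ioi_swap (measurable_gaussian_weight a)
      (fun z τ hτ => by have hτ0 : 0 < τ := hτ; positivity) _ hg ((hgi.const_mul _).congr h0.symm)]
  · refine integral_congr_ae (Eventually.of_forall fun τ => ?_)
    simp only
    rw [← integral_const_mul]
    refine integral_congr_ae (Eventually.of_forall fun z => ?_)
    simp only
    push_cast
    ring
  · filter_upwards [ae_ne_zero hN] with z hz
    exact integrableOn_rpow_mul_exp_neg_mul ha (by have := norm_pos_iff.2 hz; positivity)

lemma integrable_of_norm_le_rpow (hN : 1 ≤ N) {F : Sp N → ℝ} (hF : AEStronglyMeasurable F)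
    {a b C D : ℝ} (ha : -(N : ℝ) < a) (hb : b < -(N : ℝ)) {r : ℝ} (hr : 0 < r)
    (h1 : ∀ z : Sp N, z ≠ 0 → ‖z‖ < r → |F z| ≤ C * ‖z‖ ^ a)
    (h2 : ∀ z : Sp N, r ≤ ‖z‖ → |F z| ≤ D * ‖z‖ ^ b) : Integrable F := by
  rw [← integrableOn_univ, ← union_compl_self (Metric.ball (0 : Sp N) r)]
  refine IntegrableOn.union ?_ ?_
  · refine ((integrableOn_ball_norm_rpow hN ha r).const_mul C).mono' hF.restrict ?_
    refine (ae_restrict_iff' Metric.isOpen_ball.measurableSet).2 ?_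
    filter_upwards [ae_ne_zero hN] with z hz hzr
    exact h1 z hz (by simpa using hzr)
  · refine ((integrableOn_compl_ball_norm_rpow hb hr).const_mul D).mono' hF.restrict ?_
    refine (ae_restrict_iff' Metric.isOpen_ball.measurableSet.compl).2 (Eventually.of_forall ?_)
    intro z hzr
    exact h2 z (by simpa using hzr)

lemma one_sub_cos_mem (ξ z : Sp N) : 0 ≤ 1 - Real.cos (2 * π * inner ℝ ξ z) ∧
    1 - Real.cos (2 * π * inner ℝ ξ z) ≤ 2 ∧
    1 - Real.cos (2 * π * inner ℝ ξ z) ≤ 2 * π ^ 2 * ‖ξ‖ ^ 2 * ‖z‖ ^ 2 := by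
  have h1 := Real.one_sub_sq_div_two_le_cos (x := 2 * π * inner ℝ ξ z)
  have h2 := abs_real_inner_le_norm ξ z
  have h3 : (inner ℝ ξ z : ℝ) ^ 2 ≤ (‖ξ‖ * ‖z‖) ^ 2 := sq_le_sq' (by linarith [neg_abs_le (inner ℝ ξ z : ℝ)])
    ((le_abs_self _).trans h2)
  refine ⟨by linarith [Real.cos_le_one (2 * π * inner ℝ ξ z)],
    by linarith [Real.neg_one_le_cos (2 * π * inner ℝ ξ z)], ?_⟩
  have h4 : π ^ 2 * (inner ℝ ξ z : ℝ) ^ 2 ≤ π ^ 2 * (‖ξ‖ * ‖z‖) ^ 2 := by gcongr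
  rw [mul_pow] at h1 h4
  nlinarith

/-- The cosine cancels to second order at 0, leaving |z|^{2-N-2σ} with σ < 1; at infinity
boundedness and σ > 0 suffice. -/
lemma integrable_one_sub_cos_mul_rpow (hN : 1 ≤ N) (ξ : Sp N) {σ : ℝ} (h0 : 0 < σ) (h1 : σ < 1) :
    Integrable (fun z : Sp N => (1 - Real.cos (2 * π * inner ℝ ξ z)) *
      ‖z‖ ^ (-((N : ℝ) + 2 * σ))) := by
  refine integrable_of_norm_le_rpow hN
    (by fun_prop : Measurable fun z : Sp N => (1 - Real.cos (2 * π * inner ℝ ξ z)) *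
      ‖z‖ ^ (-((N : ℝ) + 2 * σ))).aestronglyMeasurable (C := 2 * π ^ 2 * ‖ξ‖ ^ 2) (D := 2)
    (a := 2 - ((N : ℝ) + 2 * σ)) (b := -((N : ℝ) + 2 * σ)) (by linarith) (by linarith) one_pos
    (fun z hz _ => ?_) (fun z _ => ?_)
  · obtain ⟨h2, -, h3⟩ := one_sub_cos_mem ξ z
    have hz' : 0 < ‖z‖ := norm_pos_iff.2 hz
    rw [abs_of_nonneg (by positivity), sub_eq_add_neg 2, Real.rpow_add hz', ← mul_assoc]
    gcongr
    simpa using h3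
  · obtain ⟨h2, h3, -⟩ := one_sub_cos_mem ξ z
    rw [abs_of_nonneg (by positivity)]
    gcongr

lemma integral_one_sub_cos_mul_gaussian (ξ : Sp N) {τ : ℝ} (hτ : 0 < τ) :
    ∫ z : Sp N, ((1 - Real.cos (2 * π * inner ℝ ξ z) : ℝ) : ℂ) * (Real.exp (-(‖z‖ ^ 2 * τ)) : ℂ) =
      (((π / τ) ^ ((N : ℝ) / 2) * (1 - Real.exp (-(π ^ 2 * ‖ξ‖ ^ 2 / τ))) : ℝ) : ℂ) := by
  have h1 := integral_planeWave_mul_gaussian ξ hτ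
  have h2 := integral_planeWave_mul_gaussian (0 : Sp N) hτ
  have hi : ∀ ξ : Sp N, Integrable fun z => planeWave z ξ * (Real.exp (-(‖z‖ ^ 2 * τ)) : ℂ) :=
    fun ξ => (integrable_gaussian hτ).ofReal.bdd_mul (c := 1)
      (continuous_planeWave_left ξ).aestronglyMeasurable
      (Eventually.of_forall fun z => (norm_planeWave z ξ).le)
  have h3 := integral_sub (hi 0) (hi ξ)
  rw [h1, h2, ← Complex.ofReal_sub] at h3
  have h4 : ∀ z : Sp N, (planeWave z 0 * (Real.exp (-(‖z‖ ^ 2 * τ)) : ℂ) -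
      planeWave z ξ * (Real.exp (-(‖z‖ ^ 2 * τ)) : ℂ)).re =
      (1 - Real.cos (2 * π * inner ℝ ξ z)) * Real.exp (-(‖z‖ ^ 2 * τ)) := fun z => by
    rw [← sub_mul, Complex.re_mul_ofReal, Complex.sub_re, planeWave_re, planeWave_re]
    simp
  have h5 : ∫ z, (planeWave z 0 * (Real.exp (-(‖z‖ ^ 2 * τ)) : ℂ) -
      planeWave z ξ * (Real.exp (-(‖z‖ ^ 2 * τ)) : ℂ)).re = _ :=
    (integral_re ((hi 0).sub (hi ξ))).trans (congrArg Complex.re h3)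
  simp only [h4, Complex.ofReal_re] at h5
  calc _ = ((∫ z : Sp N, (1 - Real.cos (2 * π * inner ℝ ξ z)) * Real.exp (-(‖z‖ ^ 2 * τ)) : ℝ) : ℂ) := by
        rw [← integral_complex_ofReal]
        simp only [Complex.ofReal_mul]
    _ = _ := by
        rw [h5]
        simp
        ring

lemma fracConst_pos {N : ℕ} {σ : ℝ} (h0 : 0 < σ) (h1 : σ < 1) : 0 < fracConst N σ := by
  have h2 := Real.Gamma_pos_of_pos (show 0 < ((N : ℝ) + 2 * σ) / 2 by positivity)
  have h3 := Real.Gamma_pos_of_pos (show 0 < 1 - σ by linarith)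
  unfold fracConst
  positivity

/-- After subordination the z-integral is (π/τ)^{N/2}(1 - e^{-π²|ξ|²/τ}), and the τ-integral is
`integral_rpow_mul_one_sub_exp` with b = π²|ξ|². The constant c_{N,σ} is exactly what cancels the
Gamma factors. -/
lemma fracConst_mul_integral_one_sub_cos (hN : 1 ≤ N) (ξ : Sp N) {σ : ℝ} (h0 : 0 < σ) (h1 : σ < 1) :
    fracConst N σ * ∫ z : Sp N, (1 - Real.cos (2 * π * inner ℝ ξ z)) * ‖z‖ ^ (-((N : ℝ) + 2 * σ)) =
      (2 * π * ‖ξ‖) ^ (2 * σ) := by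
  rcases eq_or_ne ξ 0 with rfl | hξ
  · simp [Real.zero_rpow (show 2 * σ ≠ 0 by positivity)]
  have hξ' : 0 < ‖ξ‖ := norm_pos_iff.2 hξ
  have ha : 0 < ((N : ℝ) + 2 * σ) / 2 := by positivity
  have h2a : -((N : ℝ) + 2 * σ) = -(2 * (((N : ℝ) + 2 * σ) / 2)) := by ring
  have hi := (integrable_one_sub_cos_mul_rpow hN ξ h0 h1).ofReal (𝕜 := ℂ)
  have h := Gamma_mul_integral_mul_rpow hN ha
    (g := fun z : Sp N => ((1 - Real.cos (2 * π * inner ℝ ξ z) : ℝ) : ℂ))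
    (by fun_prop : Continuous fun z : Sp N =>
      ((1 - Real.cos (2 * π * inner ℝ ξ z) : ℝ) : ℂ)).aestronglyMeasurable
    (by simp only [← h2a, ← Complex.ofReal_mul]; exact hi)
  rw [← h2a] at h
  simp only [← Complex.ofReal_mul] at h
  rw [integral_complex_ofReal] at h
  have h3 : ∫ τ in Ioi (0 : ℝ), ((τ ^ (((N : ℝ) + 2 * σ) / 2 - 1) : ℝ) : ℂ) *
      ∫ z : Sp N, (((1 - Real.cos (2 * π * inner ℝ ξ z)) * Real.exp (-(‖z‖ ^ 2 * τ)) : ℝ) : ℂ) =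
      ((π ^ ((N : ℝ) / 2) * ((π ^ 2 * ‖ξ‖ ^ 2) ^ σ * Real.Gamma (1 - σ) / σ) : ℝ) : ℂ) := by
    rw [← integral_rpow_mul_one_sub_exp h0 h1 (show 0 < π ^ 2 * ‖ξ‖ ^ 2 by positivity),
      ← integral_const_mul, ← integral_complex_ofReal]
    refine setIntegral_congr_fun measurableSet_Ioi fun τ hτ => ?_
    have hτ0 : 0 < τ := hτ
    have h4 := integral_one_sub_cos_mul_gaussian ξ hτ0
    simp only [← Complex.ofReal_mul] at h4
    rw [h4, ← Complex.ofReal_mul]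
    congr 1
    rw [Real.div_rpow pi_pos.le hτ0.le,
      show ((N : ℝ) + 2 * σ) / 2 - 1 = (σ - 1) + (N : ℝ) / 2 by ring, Real.rpow_add hτ0]
    have : 0 < τ ^ ((N : ℝ) / 2) := by positivity
    field_simp
  rw [h3] at h
  norm_cast at h
  have hG1 := Real.Gamma_pos_of_pos ha
  have hG2 := Real.Gamma_pos_of_pos (show 0 < 1 - σ by linarith)
  rw [fracConst]
  have h5 : (π ^ 2 * ‖ξ‖ ^ 2) ^ σ = (π * ‖ξ‖) ^ (2 * σ) := by
    rw [← mul_pow, ← Real.rpow_natCast, ← Real.rpow_mul (by positivity)]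
    norm_num
  have h6 : π ^ (-(N : ℝ) / 2) * π ^ ((N : ℝ) / 2) = 1 := by
    rw [← Real.rpow_add pi_pos, neg_div, neg_add_cancel, Real.rpow_zero]
  rw [mul_assoc 2 π, Real.mul_rpow (by positivity) (by positivity), ← h5]
  calc _ = 2 ^ (2 * σ) * π ^ (-(N : ℝ) / 2) * σ / Real.Gamma (1 - σ) *
        (Real.Gamma (((N : ℝ) + 2 * σ) / 2) * ∫ z : Sp N,
          (1 - Real.cos (2 * π * inner ℝ ξ z)) * ‖z‖ ^ (-((N : ℝ) + 2 * σ))) := by ring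
    _ = 2 ^ (2 * σ) * (π ^ 2 * ‖ξ‖ ^ 2) ^ σ * (π ^ (-(N : ℝ) / 2) * π ^ ((N : ℝ) / 2)) := by
        rw [h]
        field_simp
    _ = _ := by rw [h6, mul_one]

end kernels

/-! ### Riesz potentials and singular integrals as Fourier multipliers -/

section multipliers

variable {N : ℕ}

lemma continuous_of_planeWave {f v : Sp N → ℂ} (hf : Integrable f)
    (hv : ∀ y, v y = ∫ ξ, planeWave y ξ * f ξ) : Continuous v := by
  rw [funext hv]
  refine continuous_of_dominated (bound := fun ξ => ‖f ξ‖)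
    (fun x => (integrable_planeWave_mul hf x).aestronglyMeasurable)
    (fun x => Eventually.of_forall fun ξ => by rw [norm_mul, norm_planeWave, one_mul]) hf.norm
    (Eventually.of_forall fun ξ => (continuous_planeWave_left ξ).mul continuous_const)

lemma norm_le_of_planeWave {f v : Sp N → ℂ}
    (hv : ∀ y, v y = ∫ ξ, planeWave y ξ * f ξ) (y : Sp N) : ‖v y‖ ≤ ∫ ξ, ‖f ξ‖ := by
  rw [hv]
  refine (norm_integral_le_integral_norm _).trans_eq ?_
  simp only [norm_mul, norm_planeWave, one_mul]

/-- Both |z|^{2t-N} and |ξ|^{-2t} are superpositions of Gaussians, of widths exchanged by the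
Fourier transform. The factor τ^{-N/2} from the Gaussian turns the weight τ^{N/2-t-1} of the first
into the weight τ^{-t-1} of the second. -/
lemma kappa_mul_integral_eq (hN : 1 ≤ N) {t : ℝ} (h0 : 0 < t) (h1 : t < (N : ℝ) / 2)
    {f v : Sp N → ℂ} (hf : Integrable f)
    (hft : Integrable (fun ξ => f ξ * (((2 * π * ‖ξ‖) ^ (-(2 * t)) : ℝ) : ℂ)))
    (hv : ∀ y, v y = ∫ ξ, planeWave y ξ * f ξ) (x : Sp N)
    (hvi : Integrable (fun z => v (x - z) * ((‖z‖ ^ (2 * t - (N : ℝ)) : ℝ) : ℂ))) :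
    kappa N t * ∫ z, v (x - z) * ((‖z‖ ^ (2 * t - (N : ℝ)) : ℝ) : ℂ) =
      ∫ ξ, planeWave x ξ * f ξ * (((2 * π * ‖ξ‖) ^ (-(2 * t)) : ℝ) : ℂ) := by
  have ha : 0 < (N : ℝ) / 2 - t := by linarith
  have h2a : 2 * t - (N : ℝ) = -(2 * ((N : ℝ) / 2 - t)) := by ring
  have hvc := continuous_of_planeWave hf hv
  have hG1 := Real.Gamma_pos_of_pos ha
  have hG2 := Real.Gamma_pos_of_pos h0
  have h := Gamma_mul_integral_mul_rpow hN ha (g := fun z => v (x - z))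
    (by fun_prop : Continuous fun z => v (x - z)).aestronglyMeasurable
    (by simpa only [← h2a] using hvi)
  rw [← h2a] at h
  have hk : Measurable (Function.uncurry fun (ξ : Sp N) (τ : ℝ) =>
      τ ^ (-t - 1) * Real.exp (-(π ^ 2 * ‖ξ‖ ^ 2 / τ))) := by
    unfold Function.uncurry
    fun_prop
  have hb : ∀ ξ : Sp N, ξ ≠ 0 → 0 < π ^ 2 * ‖ξ‖ ^ 2 := fun ξ hξ => by
    have := norm_pos_iff.2 hξ
    positivity
  have hkw : ∀ ξ : Sp N, ξ ≠ 0 →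
      ∫ τ in Ioi (0 : ℝ), τ ^ (-t - 1) * Real.exp (-(π ^ 2 * ‖ξ‖ ^ 2 / τ)) =
        2 ^ (2 * t) * Real.Gamma t * (2 * π * ‖ξ‖) ^ (-(2 * t)) := fun ξ hξ => by
    rw [integral_rpow_mul_exp_neg_div h0 (hb ξ hξ), ← mul_pow, ← Real.rpow_natCast,
      ← Real.rpow_mul (by positivity), mul_assoc 2 π, Real.mul_rpow (x := 2) (by positivity)
      (by positivity), Real.rpow_neg (by positivity : (0 : ℝ) ≤ 2)]
    push_cast
    rw [mul_neg]
    field_simp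
  have h3 : (fun ξ => planeWave x ξ * f ξ *
        ((∫ τ in Ioi (0 : ℝ), τ ^ (-t - 1) * Real.exp (-(π ^ 2 * ‖ξ‖ ^ 2 / τ)) : ℝ) : ℂ)) =ᵐ[volume]
      fun ξ => ((2 ^ (2 * t) * Real.Gamma t : ℝ) : ℂ) *
        (planeWave x ξ * f ξ * (((2 * π * ‖ξ‖) ^ (-(2 * t)) : ℝ) : ℂ)) := by
    filter_upwards [ae_ne_zero hN] with ξ hξ
    rw [hkw ξ hξ]
    push_cast
    ring
  have hint : Integrable fun ξ => planeWave x ξ * f ξ * (((2 * π * ‖ξ‖) ^ (-(2 * t)) : ℝ) : ℂ) := by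
    simpa only [mul_assoc] using integrable_planeWave_mul hft x
  have hsw := integral_mul_integral_Ioi_swap hk
    (fun ξ τ hτ => by have hτ0 : 0 < τ := hτ; positivity)
    (by
      filter_upwards [ae_ne_zero hN] with ξ hξ
      exact integrableOn_rpow_mul_exp_neg_div h0 (hb ξ hξ))
    (integrable_planeWave_mul hf x).aestronglyMeasurable
    ((hint.const_mul _).congr h3.symm)
  rw [integral_congr_ae h3, integral_const_mul] at hsw
  have h4 : ∫ τ in Ioi (0 : ℝ), ((τ ^ ((N : ℝ) / 2 - t - 1) : ℝ) : ℂ) *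
      ∫ z, v (x - z) * (Real.exp (-(‖z‖ ^ 2 * τ)) : ℂ) =
      ((π ^ ((N : ℝ) / 2) : ℝ) : ℂ) * ∫ τ in Ioi (0 : ℝ), ∫ ξ, planeWave x ξ * f ξ *
        ((τ ^ (-t - 1) * Real.exp (-(π ^ 2 * ‖ξ‖ ^ 2 / τ)) : ℝ) : ℂ) := by
    rw [← integral_const_mul]
    refine setIntegral_congr_fun measurableSet_Ioi fun τ hτ => ?_
    have hτ0 : 0 < τ := hτ
    rw [integral_mul_gaussian_of_planeWave hf hv x hτ0, ← integral_const_mul, ← integral_const_mul]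
    refine integral_congr_ae (Eventually.of_forall fun ξ => ?_)
    have h5 : τ ^ ((N : ℝ) / 2 - t - 1) * (π / τ) ^ ((N : ℝ) / 2) =
        π ^ ((N : ℝ) / 2) * τ ^ (-t - 1) := by
      rw [Real.div_rpow pi_pos.le hτ0.le,
        show (N : ℝ) / 2 - t - 1 = (-t - 1) + (N : ℝ) / 2 by ring, Real.rpow_add hτ0]
      field_simp
    have h6 := congrArg (fun r : ℝ => (r : ℂ)) h5
    push_cast at h6 ⊢
    linear_combination (planeWave x ξ * f ξ * Complex.exp (-(π ^ 2 * ‖ξ‖ ^ 2 / τ))) * h6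
  rw [h4, ← hsw] at h
  have h7 : kappa N t * (π ^ ((N : ℝ) / 2) * (2 ^ (2 * t) * Real.Gamma t)) =
      Real.Gamma ((N : ℝ) / 2 - t) := by
    have h8 : π ^ (-(N : ℝ) / 2) * π ^ ((N : ℝ) / 2) = 1 := by
      rw [← Real.rpow_add pi_pos, neg_div, neg_add_cancel, Real.rpow_zero]
    have h9 : (2 : ℝ) ^ (-2 * t) * 2 ^ (2 * t) = 1 := by
      rw [← Real.rpow_add two_pos, neg_mul, neg_add_cancel, Real.rpow_zero]
    rw [kappa, add_comm 1 t, Real.Gamma_add_one h0.ne',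
      show ((N : ℝ) - 2 * t) / 2 = (N : ℝ) / 2 - t by ring]
    calc _ = (2 : ℝ) ^ (-2 * t) * 2 ^ (2 * t) * (π ^ (-(N : ℝ) / 2) * π ^ ((N : ℝ) / 2)) *
          (Real.Gamma ((N : ℝ) / 2 - t) * (t * Real.Gamma t / (t * Real.Gamma t))) := by ring
      _ = _ := by
          rw [h8, h9, div_self (by positivity)]
          ring
  have h10 := congrArg (fun r : ℝ => (r : ℂ)) h7
  have hGne : (Real.Gamma ((N : ℝ) / 2 - t) : ℂ) ≠ 0 := by exact_mod_cast hG1.ne'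
  apply mul_left_cancel₀ hGne
  rw [mul_left_comm, h, ← h10]
  push_cast
  ring

lemma indicator_compl_ball_comp_sub {E : Type*} [Zero E] (g : Sp N → E) (x : Sp N) (ε : ℝ) :
    (Metric.ball x ε)ᶜ.indicator (fun y => g (x - y)) =
      fun y => (Metric.ball (0 : Sp N) ε)ᶜ.indicator g (x - y) := by
  funext y
  simp [indicator, dist_eq_norm, norm_sub_rev]

lemma integrableOn_compl_ball_comp_sub {g : Sp N → ℝ} (x : Sp N) {ε : ℝ} :
    IntegrableOn (fun y => g (x - y)) (Metric.ball x ε)ᶜ ↔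
      IntegrableOn g (Metric.ball (0 : Sp N) ε)ᶜ := by
  rw [← integrable_indicator_iff Metric.isOpen_ball.measurableSet.compl,
    ← integrable_indicator_iff Metric.isOpen_ball.measurableSet.compl,
    indicator_compl_ball_comp_sub]
  exact integrable_comp_sub_left _ x

lemma setIntegral_compl_ball_comp_sub (g : Sp N → ℝ) (x : Sp N) (ε : ℝ) :
    ∫ y in (Metric.ball x ε)ᶜ, g (x - y) = ∫ z in (Metric.ball (0 : Sp N) ε)ᶜ, g z := by
  rw [← integral_indicator Metric.isOpen_ball.measurableSet.compl,
    ← integral_indicator Metric.isOpen_ball.measurableSet.compl, indicator_compl_ball_comp_sub]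
  exact integral_sub_left_eq_self _ _ x

lemma fracIntegrand_eq (σ : ℝ) (v : Sp N → ℝ) (x : Sp N) :
    fracIntegrand N σ v x =
      fun y => (fun z => (v x - v (x - z)) * ‖z‖ ^ (-((N : ℝ) + 2 * σ))) (x - y) := by
  funext y
  simp only [fracIntegrand, sub_sub_cancel]
  rw [Real.rpow_neg (norm_nonneg _), div_eq_mul_inv]

lemma integrableOn_fracIntegrand {σ : ℝ} (h0 : 0 < σ) {v : Sp N → ℝ} (hv : Continuous v) {M : ℝ}
    (hM : ∀ y, |v y| ≤ M) (x : Sp N) {ε : ℝ} (hε : 0 < ε) :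
    IntegrableOn (fracIntegrand N σ v x) (Metric.ball x ε)ᶜ := by
  rw [fracIntegrand_eq]
  refine (integrableOn_compl_ball_comp_sub
    (g := fun z => (v x - v (x - z)) * ‖z‖ ^ (-((N : ℝ) + 2 * σ))) x).2 ?_
  have h1 := integrableOn_compl_ball_norm_rpow (N := N) (a := -((N : ℝ) + 2 * σ)) (by linarith) hε
  refine h1.bdd_mul (c := 2 * M)
    (by fun_prop : Continuous fun z => v x - v (x - z)).aestronglyMeasurable
    (Eventually.of_forall fun z => ?_)
  rw [Real.norm_eq_abs]
  have h2 := abs_sub (v x) (v (x - z))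
  linarith [hM x, hM (x - z)]

/-- The truncated second difference symbol. -/
noncomputable def truncSymbol (N : ℕ) (σ ε : ℝ) (ξ : Sp N) : ℝ :=
  ∫ z in (Metric.ball (0 : Sp N) ε)ᶜ,
    (1 - Real.cos (2 * π * inner ℝ ξ z)) * ‖z‖ ^ (-((N : ℝ) + 2 * σ))

/-- The truncated domain and the kernel are invariant under z ↦ -z, so averaging over the two signs
removes the odd sine part. -/
lemma integral_one_sub_planeWave_mul_rpow {σ ε : ℝ} (h0 : 0 < σ) (hε : 0 < ε) (ξ : Sp N) :
    ∫ z in (Metric.ball (0 : Sp N) ε)ᶜ, (1 - planeWave (-z) ξ) *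
      ((‖z‖ ^ (-((N : ℝ) + 2 * σ)) : ℝ) : ℂ) = truncSymbol N σ ε ξ := by
  have hS : MeasurableSet (Metric.ball (0 : Sp N) ε)ᶜ := Metric.isOpen_ball.measurableSet.compl
  set h : Sp N → ℂ := fun z => (1 - planeWave (-z) ξ) * ((‖z‖ ^ (-((N : ℝ) + 2 * σ)) : ℝ) : ℂ)
  have hi : IntegrableOn h (Metric.ball (0 : Sp N) ε)ᶜ := by
    refine (integrableOn_compl_ball_norm_rpow (N := N) (a := -((N : ℝ) + 2 * σ))
      (by linarith) hε).ofReal.bdd_mul (c := 2)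
      (by have := continuous_planeWave_left ξ; fun_prop : Continuous fun z : Sp N =>
        1 - planeWave (-z) ξ).aestronglyMeasurable
      (Eventually.of_forall fun z => ?_)
    refine (norm_sub_le _ _).trans ?_
    rw [norm_planeWave, norm_one]
    norm_num
  have hneg : ∫ z in (Metric.ball (0 : Sp N) ε)ᶜ, h (-z) = ∫ z in (Metric.ball (0 : Sp N) ε)ᶜ, h z := by
    rw [← integral_indicator hS, ← integral_indicator hS, ← integral_neg_eq_self]
    refine integral_congr_ae (Eventually.of_forall fun z => ?_)
    simp [indicator]
  have hi' : IntegrableOn (fun z => h (-z)) (Metric.ball (0 : Sp N) ε)ᶜ := by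
    rw [← integrable_indicator_iff hS] at hi ⊢
    refine hi.comp_neg.congr (Eventually.of_forall fun z => ?_)
    simp [indicator]
  have hadd := integral_add hi hi'
  rw [hneg, ← two_mul] at hadd
  have h2 : ∀ z, h z + h (-z) = 2 * (((1 - Real.cos (2 * π * inner ℝ ξ z)) *
      ‖z‖ ^ (-((N : ℝ) + 2 * σ)) : ℝ) : ℂ) := fun z => by
    have h3 := planeWave_add_neg z ξ
    simp only [h, neg_neg, norm_neg]
    rw [← add_mul, show 1 - planeWave (-z) ξ + (1 - planeWave z ξ) =
      2 - (planeWave z ξ + planeWave (-z) ξ) by ring, h3]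
    push_cast
    ring
  simp only [h2] at hadd
  rw [integral_const_mul, integral_complex_ofReal] at hadd
  exact (mul_left_cancel₀ two_ne_zero hadd).symm

lemma tendsto_setIntegral_compl_ball (hN : 1 ≤ N) {g : Sp N → ℝ} (hg : Integrable g) :
    Tendsto (fun ε => ∫ z in (Metric.ball (0 : Sp N) ε)ᶜ, g z) (𝓝[>] 0) (𝓝 (∫ z, g z)) := by
  have hS : ∀ ε : ℝ, MeasurableSet (Metric.ball (0 : Sp N) ε)ᶜ := fun ε =>
    Metric.isOpen_ball.measurableSet.compl
  simp only [← integral_indicator (hS _)]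
  refine tendsto_integral_filter_of_dominated_convergence _
    (Eventually.of_forall fun ε => hg.aestronglyMeasurable.indicator (hS ε))
    (Eventually.of_forall fun ε => Eventually.of_forall fun z => norm_indicator_le_norm_self _ _)
    hg.norm ?_
  filter_upwards [ae_ne_zero hN] with z hz
  refine tendsto_const_nhds.congr' ?_
  have h3 : ∀ᶠ ε : ℝ in 𝓝[>] 0, ε < ‖z‖ :=
    nhdsWithin_le_nhds (Iio_mem_nhds (norm_pos_iff.2 hz))
  filter_upwards [h3] with ε hε
  rw [indicator_of_mem (by simpa using hε.le)]

lemma tendsto_truncSymbol (hN : 1 ≤ N) {σ : ℝ} (h0 : 0 < σ) (h1 : σ < 1) (ξ : Sp N) :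
    Tendsto (fun ε => truncSymbol N σ ε ξ) (𝓝[>] 0)
      (𝓝 ((2 * π * ‖ξ‖) ^ (2 * σ) / fracConst N σ)) := by
  rw [← fracConst_mul_integral_one_sub_cos hN ξ h0 h1,
    mul_div_cancel_left₀ _ (fracConst_pos h0 h1).ne']
  exact tendsto_setIntegral_compl_ball hN (integrable_one_sub_cos_mul_rpow hN ξ h0 h1)

/-- Nonnegativity of the integrand bounds every truncation by the full integral; this gives the
dominating function for the limit ε → 0⁺. -/
lemma truncSymbol_mem (hN : 1 ≤ N) {σ : ℝ} (h0 : 0 < σ) (h1 : σ < 1) (ε : ℝ) (ξ : Sp N) :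
    0 ≤ truncSymbol N σ ε ξ ∧ truncSymbol N σ ε ξ ≤ (2 * π * ‖ξ‖) ^ (2 * σ) / fracConst N σ := by
  have hc := fracConst_pos (N := N) h0 h1
  rw [← fracConst_mul_integral_one_sub_cos hN ξ h0 h1, mul_div_cancel_left₀ _ hc.ne']
  have hnn : ∀ z : Sp N, 0 ≤ (1 - Real.cos (2 * π * inner ℝ ξ z)) * ‖z‖ ^ (-((N : ℝ) + 2 * σ)) :=
    fun z => mul_nonneg (one_sub_cos_mem ξ z).1 (by positivity)
  exact ⟨integral_nonneg hnn, setIntegral_le_integral (integrable_one_sub_cos_mul_rpow hN ξ h0 h1)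
    (Eventually.of_forall hnn)⟩

/-- The singular integral of order `σ` acts as the Fourier multiplier `|2πξ|^{2σ}`. -/
lemma tendsto_fracTruncated (hN : 1 ≤ N) {σ : ℝ} (h0 : 0 < σ) (h1 : σ < 1) {f : Sp N → ℂ}
    {v : Sp N → ℝ} (hf : Integrable f)
    (hfs : Integrable (fun ξ => f ξ * (((2 * π * ‖ξ‖) ^ (2 * σ) : ℝ) : ℂ)))
    (hv : ∀ y, (v y : ℂ) = ∫ ξ, planeWave y ξ * f ξ) (x : Sp N) :
    ∃ l : ℝ, Tendsto (fracTruncated N σ v x) (𝓝[>] 0) (𝓝 l) ∧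
      ((fracConst N σ * l : ℝ) : ℂ) =
        ∫ ξ, planeWave x ξ * f ξ * (((2 * π * ‖ξ‖) ^ (2 * σ) : ℝ) : ℂ) := by
  have hc := fracConst_pos (N := N) h0 h1
  have hS : ∀ ε : ℝ, MeasurableSet (Metric.ball (0 : Sp N) ε)ᶜ := fun ε =>
    Metric.isOpen_ball.measurableSet.compl
  -- Truncation makes the kernel integrable, so Fubini applies for fixed ε; without it, the double
  -- integral need not converge absolutely.
  have hint : ∀ ε : ℝ, 0 < ε → Integrable (Function.uncurry fun z ξ : Sp N =>
      planeWave x ξ * (1 - planeWave (-z) ξ) * (((‖z‖ ^ (-((N : ℝ) + 2 * σ)) : ℝ) : ℂ) * f ξ))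
      ((volume.restrict (Metric.ball (0 : Sp N) ε)ᶜ).prod volume) := fun ε hε => by
    have h2 := (integrableOn_compl_ball_norm_rpow (N := N) (a := -((N : ℝ) + 2 * σ))
      (by linarith) hε).ofReal (𝕜 := ℂ) |>.mul_prod hf
    refine h2.bdd_mul (c := 2) ?_ (Eventually.of_forall fun p => ?_)
    · have e1 := continuous_planeWave.comp (f := fun p : Sp N × Sp N => (x, p.2)) (by fun_prop)
      have e2 := continuous_planeWave.comp (f := fun p : Sp N × Sp N => (-p.1, p.2)) (by fun_prop)
      exact (e1.mul (continuous_const.sub e2)).aestronglyMeasurable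
    · rw [norm_mul, norm_planeWave, one_mul]
      refine (norm_sub_le _ _).trans ?_
      rw [norm_planeWave, norm_one]
      norm_num
  have hinner : ∀ ε : ℝ, 0 < ε → ∀ ξ, ∫ z in (Metric.ball (0 : Sp N) ε)ᶜ,
      planeWave x ξ * (1 - planeWave (-z) ξ) * (((‖z‖ ^ (-((N : ℝ) + 2 * σ)) : ℝ) : ℂ) * f ξ) =
      planeWave x ξ * f ξ * truncSymbol N σ ε ξ := fun ε hε ξ => by
    rw [← integral_one_sub_planeWave_mul_rpow h0 hε ξ, ← integral_const_mul]
    exact integral_congr_ae (Eventually.of_forall fun z => by simp only; ring)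
  have htr : ∀ ε : ℝ, 0 < ε → (fracTruncated N σ v x ε : ℂ) =
      ∫ ξ, planeWave x ξ * f ξ * truncSymbol N σ ε ξ := fun ε hε => by
    rw [← integral_congr_ae (Eventually.of_forall (hinner ε hε)),
      ← integral_integral_swap (hint ε hε), fracTruncated, fracIntegrand_eq,
      setIntegral_compl_ball_comp_sub, ← integral_complex_ofReal]
    refine integral_congr_ae (Eventually.of_forall fun z => ?_)
    simp only
    push_cast
    rw [hv, hv, ← integral_sub (integrable_planeWave_mul hf _) (integrable_planeWave_mul hf _),
      ← integral_mul_const]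
    refine integral_congr_ae (Eventually.of_forall fun ξ => ?_)
    simp only [planeWave_sub]
    ring
  have hlim : Tendsto (fun ε => (fracTruncated N σ v x ε : ℂ)) (𝓝[>] 0)
      (𝓝 (∫ ξ, planeWave x ξ * f ξ * (((2 * π * ‖ξ‖) ^ (2 * σ) / fracConst N σ : ℝ) : ℂ))) := by
    have hlim' : Tendsto (fun ε => ∫ ξ, planeWave x ξ * f ξ * truncSymbol N σ ε ξ) (𝓝[>] 0)
        (𝓝 (∫ ξ, planeWave x ξ * f ξ * (((2 * π * ‖ξ‖) ^ (2 * σ) / fracConst N σ : ℝ) : ℂ))) := by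
      refine tendsto_integral_filter_of_dominated_convergence
        (fun ξ => ‖f ξ * (((2 * π * ‖ξ‖) ^ (2 * σ) : ℝ) : ℂ)‖ * (fracConst N σ)⁻¹) ?_ ?_
        (hfs.norm.mul_const _) ?_
      · filter_upwards [self_mem_nhdsWithin] with ε hε
        exact (hint ε hε).integral_prod_right.aestronglyMeasurable.congr
          (Eventually.of_forall (hinner ε hε))
      · refine Eventually.of_forall fun ε => Eventually.of_forall fun ξ => ?_
        obtain ⟨h3, h4⟩ := truncSymbol_mem hN h0 h1 ε ξ
        rw [norm_mul, norm_mul, norm_mul, norm_planeWave, one_mul, Complex.norm_real,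
          Complex.norm_real, Real.norm_of_nonneg h3, Real.norm_of_nonneg (by positivity), mul_assoc,
          ← div_eq_mul_inv]
        gcongr
      · refine Eventually.of_forall fun ξ => ?_
        exact tendsto_const_nhds.mul
          ((Complex.continuous_ofReal.tendsto _).comp (tendsto_truncSymbol hN h0 h1 ξ))
    refine hlim'.congr' ?_
    filter_upwards [self_mem_nhdsWithin] with ε hε using (htr ε hε).symm
  have hre : Tendsto (fracTruncated N σ v x) (𝓝[>] 0) (𝓝 _) :=
    ((Complex.continuous_re.tendsto _).comp hlim).congr fun ε => Complex.ofReal_re _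
  refine ⟨_, hre, ?_⟩
  have h5 := tendsto_nhds_unique hlim ((Complex.continuous_ofReal.tendsto _).comp hre)
  rw [Complex.ofReal_mul, ← h5, ← integral_const_mul]
  refine integral_congr_ae (Eventually.of_forall fun ξ => ?_)
  have : (fracConst N σ : ℂ) ≠ 0 := by exact_mod_cast hc.ne'
  simp only
  push_cast
  field_simp

end multipliers

/-! ### The symbol of the powers of the Laplacian -/

section spectral

variable {N : ℕ}

/-- The symbol `|2πξ|^{2s} 𝓕φ(ξ)` of the order-`2s` power of the Laplacian applied to `φ`. -/
noncomputable def powSymbol (φ : 𝓢(Sp N, ℂ)) (s : ℝ) (ξ : Sp N) : ℂ :=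
  𝓕 φ ξ * (((2 * π * ‖ξ‖) ^ (2 * s) : ℝ) : ℂ)

lemma integrable_schwartz_mul_rpow (hN : 1 ≤ N) (ψ : 𝓢(Sp N, ℂ)) {a : ℝ} (ha : -(N : ℝ) < a) :
    Integrable (fun ξ => ψ ξ * (((2 * π * ‖ξ‖) ^ a : ℝ) : ℂ)) := by
  have hψ := ψ.continuous
  have hm : Measurable fun ξ => ψ ξ * (((2 * π * ‖ξ‖) ^ a : ℝ) : ℂ) :=
    hψ.measurable.mul (Complex.measurable_ofReal.comp (by fun_prop))
  rw [← integrable_norm_iff hm.aestronglyMeasurable]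
  -- Schwartz decay of order k > N + a brings the exponent at infinity to a - k < -N.
  obtain ⟨k, hk⟩ := exists_nat_gt ((N : ℝ) + a)
  obtain ⟨C, -, hC⟩ := ψ.decay 0 0
  obtain ⟨D, -, hD⟩ := ψ.decay k 0
  simp only [norm_iteratedFDeriv_zero, pow_zero, one_mul] at hC hD
  refine integrable_of_norm_le_rpow hN hm.norm.aestronglyMeasurable (a := a) (b := a - k)
    (C := C * (2 * π) ^ a) (D := D * (2 * π) ^ a) ha (by linarith) one_pos
    (fun z _ _ => ?_) (fun z hz => ?_)
  · rw [abs_norm, norm_mul, Complex.norm_real, Real.norm_of_nonneg (by positivity),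
      Real.mul_rpow (by positivity) (by positivity), ← mul_assoc]
    gcongr
    exact hC z
  · have hz0 : 0 < ‖z‖ := one_pos.trans_le hz
    rw [abs_norm, norm_mul, Complex.norm_real, Real.norm_of_nonneg (by positivity),
      Real.mul_rpow (by positivity) (by positivity), Real.rpow_sub hz0, Real.rpow_natCast]
    have h1 := hD z
    have h2 : ‖ψ z‖ ≤ D / ‖z‖ ^ k := by rw [le_div_iff₀ (by positivity)]; linarith
    calc ‖ψ z‖ * ((2 * π) ^ a * ‖z‖ ^ a) ≤ D / ‖z‖ ^ k * ((2 * π) ^ a * ‖z‖ ^ a) := by gcongr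
      _ = _ := by ring

lemma integrable_powSymbol (hN : 1 ≤ N) (φ : 𝓢(Sp N, ℂ)) {s : ℝ} (hs : -(N : ℝ) / 2 < s) :
    Integrable (powSymbol φ s) :=
  integrable_schwartz_mul_rpow hN (𝓕 φ) (by linarith)

/-- The origin is excluded because the convention 0^0 = 1 breaks additivity of exponents there; it
is a null set. -/
lemma powSymbol_add (φ : 𝓢(Sp N, ℂ)) (s t : ℝ) {ξ : Sp N} (hξ : ξ ≠ 0) :
    powSymbol φ (s + t) ξ = powSymbol φ s ξ * (((2 * π * ‖ξ‖) ^ (2 * t) : ℝ) : ℂ) := by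
  have hξ' : 0 < ‖ξ‖ := norm_pos_iff.2 hξ
  rw [powSymbol, powSymbol, mul_add, Real.rpow_add (by positivity)]
  push_cast
  ring

lemma schwartz_eq_integral_planeWave (φ : 𝓢(Sp N, ℂ)) (y : Sp N) :
    φ y = ∫ ξ, planeWave y ξ * 𝓕 φ ξ := by
  have h : φ = 𝓕⁻ (𝓕 φ) := (FourierTransform.fourierInv_fourier_eq φ).symm
  conv_lhs => rw [h]
  rw [SchwartzMap.fourierInv_coe, Real.fourierInv_eq']
  simp only [planeWave, smul_eq_mul]

open Laplacian in
lemma fourier_neg_laplacian (ψ : 𝓢(Sp N, ℂ)) (ξ : Sp N) :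
    𝓕 (-(Δ ψ)) ξ = (((2 * π * ‖ξ‖) ^ 2 : ℝ) : ℂ) * 𝓕 ψ ξ := by
  rw [SchwartzMap.laplacian_eq_fourierMultiplierCLM, ← neg_smul, neg_neg,
    FourierTransform.fourier_smul, SchwartzMap.fourierMultiplierCLM_apply,
    FourierTransform.fourier_fourierInv_eq, _root_.smul_apply,
    SchwartzMap.smulLeftCLM_apply_apply (by fun_prop)]
  simp
  ring

end spectral

/-! ### Integer powers of the Laplacian -/

section integer_powers

variable {N : ℕ}

open Laplacian in
-- Schwartz functions are taken complex-valued for the Fourier transform; the Laplacian commutes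
-- with the real-linear embedding ℝ → ℂ, so the real iterates are recovered.
lemma exists_schwartz_negLaplacianPow {u : Sp N → ℝ} {φ : 𝓢(Sp N, ℂ)} (hφ : ∀ x, φ x = (u x : ℂ))
    (k : ℕ) : ∃ ψ : 𝓢(Sp N, ℂ), (∀ x, ψ x = (negLaplacianPow N k u x : ℂ)) ∧
      ∀ ξ, 𝓕 ψ ξ = (((2 * π * ‖ξ‖) ^ (2 * k) : ℝ) : ℂ) * 𝓕 φ ξ := by
  induction k with
  | zero => exact ⟨φ, hφ, fun ξ => by simp⟩
  | succ k ih =>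
    obtain ⟨ψ, h1, h2⟩ := ih
    refine ⟨-(Δ ψ), fun x => ?_, fun ξ => ?_⟩
    · have h3 : ContDiff ℝ ∞ (negLaplacianPow N k u) := by
        have h4 : negLaplacianPow N k u = fun x => Complex.reCLM (ψ x) := by
          funext x
          simp [h1]
        rw [h4]
        exact Complex.reCLM.contDiff.comp ψ.smooth'
      have h5 : (ψ : Sp N → ℂ) = Complex.ofRealCLM ∘ negLaplacianPow N k u := by
        funext x
        simp [h1]
      have h6 : ContDiffAt ℝ 2 (negLaplacianPow N k u) x := (contDiff_infty.1 h3 2).contDiffAt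
      rw [_root_.neg_apply, SchwartzMap.laplacian_apply, h5, h6.laplacian_CLM_comp_left]
      simp only [negLaplacianPow, Function.iterate_succ_apply']
      simp
    · rw [fourier_neg_laplacian, h2]
      push_cast
      ring

lemma negLaplacianPow_eq_zero {u : Sp N → ℝ} {R : ℝ} (hR : ∀ x, R < ‖x‖ → u x = 0) (k : ℕ) :
    ∀ x, R < ‖x‖ → negLaplacianPow N k u x = 0 := by
  induction k with
  | zero => exact hR
  | succ k ih =>
    intro x hx
    have h1 : negLaplacianPow N k u =ᶠ[𝓝 x] fun _ => 0 := by
      filter_upwards [(isOpen_lt continuous_const continuous_norm).mem_nhds hx] with y hy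
      exact ih y hy
    have h2 := InnerProductSpace.laplacian_congr_nhds h1
    have h3 := h2.self_of_nhds
    have h4 : negLaplacianPow N (k + 1) u x = -(Laplacian.laplacian (negLaplacianPow N k u) x) := by
      simp only [negLaplacianPow, Function.iterate_succ_apply']
    rw [h4, h3]
    simp

end integer_powers

/-! ### Compactly supported functions against powers of the distance -/

section decay

variable {N : ℕ}

lemma integrable_comp_sub_mul_rpow (hN : 1 ≤ N) {w : Sp N → ℝ} (hw : Continuous w) {R : ℝ}
    (hR : ∀ x, R < ‖x‖ → w x = 0) {M : ℝ} (hM : ∀ x, |w x| ≤ M) {a : ℝ} (ha : -(N : ℝ) < a)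
    (x : Sp N) : Integrable (fun z => w (x - z) * ‖z‖ ^ a) := by
  have hm : Measurable fun z => w (x - z) * ‖z‖ ^ a :=
    (by fun_prop : Continuous fun z => w (x - z)).measurable.mul (by fun_prop)
  refine integrable_of_norm_le_rpow hN hm.aestronglyMeasurable (C := M) (D := 0) (a := a)
    (b := -N - 1) (r := |R| + ‖x‖ + 1) ha (by linarith) (by positivity) (fun z _ _ => ?_)
    (fun z hz => ?_)
  · rw [abs_mul, abs_of_nonneg (by positivity : 0 ≤ ‖z‖ ^ a)]
    gcongr
    exact hM _
  · have h1 : R < ‖x - z‖ := by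
      have h2 := norm_sub_norm_le z x
      rw [norm_sub_rev] at h2
      linarith [le_abs_self R]
    rw [hR _ h1]
    simp

/-- Averages of a compactly supported function against a negative power of the distance decay. -/
lemma norm_mul_rpow_dist_le {w : Sp N → ℝ} {R : ℝ} (hR : ∀ x, R < ‖x‖ → w x = 0) {a : ℝ}
    (ha : a ≤ 0) {y : Sp N} (hy0 : 0 < ‖y‖) (hy : 2 * R ≤ ‖y‖) (z : Sp N) :
    |w z| * ‖y - z‖ ^ a ≤ |w z| * (‖y‖ / 2) ^ a := by
  by_cases hz : R < ‖z‖
  · simp [hR z hz]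
  · have h1 := norm_sub_norm_le y z
    gcongr ?_ * ?_
    exact Real.rpow_le_rpow_of_nonpos (by positivity) (by linarith [not_lt.1 hz]) ha

end decay

/-! ### Convergence, symbol and decay of 𝓑^s u -/

section identification

variable {N : ℕ}

lemma integral_planeWave_mul_mul_eq {f g : Sp N → ℂ} {m : Sp N → ℂ} (hN : 1 ≤ N)
    (h : ∀ ξ, ξ ≠ 0 → g ξ = f ξ * m ξ) (x : Sp N) :
    ∫ ξ, planeWave x ξ * f ξ * m ξ = ∫ ξ, planeWave x ξ * g ξ := by
  refine integral_congr_ae ?_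
  filter_upwards [ae_ne_zero hN] with ξ hξ
  rw [h ξ hξ, mul_assoc]

lemma continuous_of_coe_schwartz {w : Sp N → ℝ} {ψ : 𝓢(Sp N, ℂ)} (h : ∀ x, ψ x = (w x : ℂ)) :
    Continuous w := by
  have h1 : w = fun x => (ψ x).re := by
    funext x
    simp [h]
  rw [h1]
  exact Complex.continuous_re.comp ψ.continuous

lemma bounded_of_coe_schwartz {w : Sp N → ℝ} {ψ : 𝓢(Sp N, ℂ)} (h : ∀ x, ψ x = (w x : ℂ)) :
    ∃ M, ∀ x, |w x| ≤ M := by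
  obtain ⟨M, -, hM⟩ := ψ.decay 0 0
  refine ⟨M, fun x => ?_⟩
  simpa [h] using hM x

lemma integrable_of_coe_schwartz {w : Sp N → ℝ} {ψ : 𝓢(Sp N, ℂ)} (h : ∀ x, ψ x = (w x : ℂ)) :
    Integrable w := by
  refine ψ.integrable.re.congr (Eventually.of_forall fun x => ?_)
  simp [h]

/-- The defining integrals of `𝓑^s u` converge, `𝓑^s` is the Fourier multiplier `|2πξ|^{2s}`, and
`𝓑^s u` decays polynomially outside the ball of radius `2R`. -/
def BSpec (u : Sp N → ℝ) (φ : 𝓢(Sp N, ℂ)) (R s : ℝ) : Prop :=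
  (∀ x, BConvergesAt N s u x) ∧
  (∀ x, (B N s u x : ℂ) = ∫ ξ, planeWave x ξ * powSymbol φ s ξ) ∧
  (∃ η : ℝ, 0 < η ∧ ∃ C : ℝ, ∀ y : Sp N, 0 < ‖y‖ → 2 * R ≤ ‖y‖ → |B N s u y| ≤ C * ‖y‖ ^ (-η))

variable {u : Sp N → ℝ} {φ : 𝓢(Sp N, ℂ)} {R s : ℝ}

lemma bSpec_of_neg (hN : 1 ≤ N) (hφ : ∀ x, φ x = (u x : ℂ)) (hR : ∀ x, R < ‖x‖ → u x = 0)
    (hs : -(N : ℝ) / 2 < s) (hs0 : s < 0) : BSpec u φ R s := by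
  have hB : ∀ x, B N s u x = rieszPotential N (-s) u x := fun x => by simp [B, hs0]
  have ha : -(N : ℝ) < 2 * (-s) - N := by linarith
  obtain ⟨M, hM⟩ := bounded_of_coe_schwartz hφ
  have hi := fun x => integrable_comp_sub_mul_rpow hN (continuous_of_coe_schwartz hφ) hR hM ha x
  have hi2 : ∀ x, Integrable (fun y => rieszKernel N (-s) (x - y) * u y) := fun x => by
    refine (((hi x).comp_sub_left x).const_mul (kappa N (-s))).congr
      (Eventually.of_forall fun y => ?_)
    simp only [rieszKernel, sub_sub_cancel]
    ring
  refine ⟨fun x => ⟨fun _ => hi2 x, fun h => absurd h (not_lt.2 hs0.le)⟩, fun x => ?_, ?_⟩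
  · have h := kappa_mul_integral_eq hN (t := -s) (by linarith) (by linarith) (𝓕 φ).integrable
      (integrable_schwartz_mul_rpow hN (𝓕 φ) (by linarith)) (schwartz_eq_integral_planeWave φ) x
      (by
        simp only [hφ, ← Complex.ofReal_mul]
        exact (hi x).ofReal)
    have h2 : B N s u x = kappa N (-s) * ∫ z, u (x - z) * ‖z‖ ^ (2 * (-s) - (N : ℝ)) := by
      rw [hB, rieszPotential, ← integral_sub_left_eq_self _ _ x, ← integral_const_mul]
      refine integral_congr_ae (Eventually.of_forall fun y => ?_)
      simp only [rieszKernel, sub_sub_cancel]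
      ring
    simp only [hφ, ← Complex.ofReal_mul] at h
    rw [integral_complex_ofReal, ← Complex.ofReal_mul, ← h2] at h
    rw [h]
    refine integral_planeWave_mul_mul_eq hN (fun ξ _ => ?_) x
    rw [powSymbol, show -(2 * -s) = 2 * s by ring]
  -- Away from the support the potential decays like its kernel |y|^{-(2s+N)}, and 2s + N > 0 is the
  -- assumption on s.
  · refine ⟨2 * s + N, by linarith,
      |kappa N (-s)| * (∫ z, |u z|) * (1 / 2) ^ (-(2 * s + (N : ℝ))), fun y hy0 hy => ?_⟩
    rw [hB, rieszPotential]
    have h1 : ‖∫ z, rieszKernel N (-s) (y - z) * u z‖ ≤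
        ∫ z, |kappa N (-s)| * (|u z| * (‖y‖ / 2) ^ (-(2 * s + (N : ℝ)))) := by
      refine norm_integral_le_of_norm_le
        (((integrable_of_coe_schwartz hφ).norm.mul_const _).const_mul _)
        (Eventually.of_forall fun z => ?_)
      have h2 := norm_mul_rpow_dist_le hR (a := -(2 * s + (N : ℝ))) (by linarith) hy0 hy z
      rw [rieszKernel, show 2 * (-s) - (N : ℝ) = -(2 * s + N) by ring, norm_mul, norm_mul,
        Real.norm_eq_abs, Real.norm_of_nonneg (by positivity : 0 ≤ ‖y - z‖ ^ (-(2 * s + (N : ℝ)))),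
        Real.norm_eq_abs, mul_assoc, mul_comm (‖y - z‖ ^ _)]
      gcongr ?_ * ?_
    refine h1.trans_eq ?_
    rw [integral_const_mul, integral_mul_const, div_eq_mul_one_div,
      Real.mul_rpow (by positivity) (by positivity)]
    ring

lemma natFloor_add_fract (hs0 : 0 ≤ s) : ((⌊s⌋₊ : ℕ) : ℝ) + Int.fract s = s := by
  rw [natCast_floor_eq_intCast_floor hs0]
  exact Int.floor_add_fract s

lemma fourier_eq_powSymbol_natCast {ψ : 𝓢(Sp N, ℂ)} {k : ℕ}
    (hψF : ∀ ξ, 𝓕 ψ ξ = (((2 * π * ‖ξ‖) ^ (2 * k) : ℝ) : ℂ) * 𝓕 φ ξ) (ξ : Sp N) :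
    𝓕 ψ ξ = powSymbol φ k ξ := by
  rw [hψF, powSymbol, mul_comm, ← Real.rpow_natCast (2 * π * ‖ξ‖) (2 * k)]
  push_cast
  rfl

lemma bSpec_of_fract_eq_zero (hφ : ∀ x, φ x = (u x : ℂ)) (hR : ∀ x, R < ‖x‖ → u x = 0)
    (hs0 : 0 ≤ s) (hfr : Int.fract s = 0) : BSpec u φ R s := by
  have hfl := natFloor_add_fract hs0
  rw [hfr, add_zero] at hfl
  obtain ⟨ψ, hψ, hψF⟩ := exists_schwartz_negLaplacianPow hφ ⌊s⌋₊
  have hRw := negLaplacianPow_eq_zero hR ⌊s⌋₊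
  have hB : ∀ x, B N s u x = negLaplacianPow N ⌊s⌋₊ u x := fun x => by
    simp [B, not_lt.2 hs0, laplacianPow, hfr]
  refine ⟨fun x => ⟨fun h => absurd h (not_lt.2 hs0), fun _ h => absurd hfr h⟩, fun x => ?_, ?_⟩
  · rw [hB, ← hψ, schwartz_eq_integral_planeWave]
    simp only [fourier_eq_powSymbol_natCast hψF, hfl]
  -- The function vanishes here: ‖y‖ > 0 and ‖y‖ ≥ 2R force ‖y‖ > R, whatever the sign of R.
  · refine ⟨1, one_pos, 0, fun y hy0 hy => ?_⟩
    rw [hB, hRw y (by linarith), abs_zero, zero_mul]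

lemma bSpec_of_fract_ne_zero (hN : 1 ≤ N) (hφ : ∀ x, φ x = (u x : ℂ))
    (hR : ∀ x, R < ‖x‖ → u x = 0) (hs0 : 0 ≤ s) (hfr : Int.fract s ≠ 0) : BSpec u φ R s := by
  have hfl := natFloor_add_fract hs0
  obtain ⟨ψ, hψ, hψF⟩ := exists_schwartz_negLaplacianPow hφ ⌊s⌋₊
  have hRw := negLaplacianPow_eq_zero hR ⌊s⌋₊
  set w := negLaplacianPow N ⌊s⌋₊ u with hw
  have hσ0 : 0 < Int.fract s := lt_of_le_of_ne (Int.fract_nonneg s) (Ne.symm hfr)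
  have hσ1 := Int.fract_lt_one s
  have hN0 : (0 : ℝ) ≤ N := N.cast_nonneg
  obtain ⟨M, hM⟩ := bounded_of_coe_schwartz hψ
  have hwint := integrable_of_coe_schwartz hψ
  have hv : ∀ y, (w y : ℂ) = ∫ ξ, planeWave y ξ * 𝓕 ψ ξ := fun y =>
    (hψ y).symm.trans (schwartz_eq_integral_planeWave ψ y)
  have hint : Integrable (fun ξ => 𝓕 ψ ξ * (((2 * π * ‖ξ‖) ^ (2 * Int.fract s) : ℝ) : ℂ)) :=
    integrable_schwartz_mul_rpow hN (𝓕 ψ) (by linarith)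
  have hlim : ∀ x, _ := tendsto_fracTruncated hN hσ0 hσ1 (𝓕 ψ).integrable hint hv
  choose l hl1 hl2 using hlim
  have hB : ∀ x, B N s u x = fracConst N (Int.fract s) * l x := fun x => by
    simp only [B, not_lt.2 hs0, if_false, laplacianPow]
    rw [if_neg hfr, fracLaplacian, (hl1 x).limUnder_eq]
  refine ⟨fun x => ⟨fun h => absurd h (not_lt.2 hs0), fun _ _ =>
    ⟨fun ε hε => integrableOn_fracIntegrand hσ0 (continuous_of_coe_schwartz hψ) hM x hε, l x,
      hl1 x⟩⟩, fun x => ?_, ?_⟩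
  · rw [hB, hl2]
    refine integral_planeWave_mul_mul_eq hN (fun ξ hξ => ?_) x
    rw [fourier_eq_powSymbol_natCast hψF, ← powSymbol_add φ _ _ hξ, hfl]
  · set σ := Int.fract s
    refine ⟨(N : ℝ) + 2 * σ, by positivity,
      |fracConst N σ| * ((∫ z, |w z|) * (1 / 2) ^ (-((N : ℝ) + 2 * σ))), fun y hy0 hy => ?_⟩
    have hy1 : R < ‖y‖ := by linarith
    rw [hB, abs_mul, mul_assoc]
    gcongr
    -- Since w(y) = 0, only the values of w on its support, at distance at least ‖y‖/2, contribute.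
    -- The resulting bound on the truncated integrals is uniform in ε and passes to the limit.
    refine le_of_tendsto (hl1 y).abs (Eventually.of_forall fun ε => ?_)
    have h1 : ‖∫ z in (Metric.ball y ε)ᶜ, fracIntegrand N σ w y z‖ ≤
        ∫ z in (Metric.ball y ε)ᶜ, |w z| * (‖y‖ / 2) ^ (-((N : ℝ) + 2 * σ)) := by
      refine norm_integral_le_of_norm_le (hwint.norm.mul_const _).integrableOn
        (Eventually.of_forall fun z => ?_)
      have h2 := norm_mul_rpow_dist_le hRw (a := -((N : ℝ) + 2 * σ)) (by linarith) hy0 hy z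
      rw [fracIntegrand, hRw y hy1, zero_sub, div_eq_mul_inv, ← Real.rpow_neg (norm_nonneg _),
        norm_mul, norm_neg, Real.norm_of_nonneg (by positivity : 0 ≤ ‖y - z‖ ^ (-((N : ℝ) + 2 * σ)))]
      exact h2
    refine h1.trans ((setIntegral_le_integral (hwint.norm.mul_const _)
      (Eventually.of_forall fun z => by positivity)).trans_eq ?_)
    simp only [Real.norm_eq_abs]
    rw [integral_mul_const, div_eq_mul_one_div, Real.mul_rpow (by positivity) (by positivity)]
    ring

lemma bSpec (hN : 1 ≤ N) (hφ : ∀ x, φ x = (u x : ℂ)) (hR : ∀ x, R < ‖x‖ → u x = 0)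
    (hs : -(N : ℝ) / 2 < s) : BSpec u φ R s := by
  rcases lt_or_ge s 0 with hs0 | hs0
  · exact bSpec_of_neg hN hφ hR hs hs0
  · by_cases hfr : Int.fract s = 0
    · exact bSpec_of_fract_eq_zero hφ hR hs0 hfr
    · exact bSpec_of_fract_ne_zero hN hφ hR hs0 hfr

end identification

/-! ### The logarithmic kernels and the splitting at the unit ball -/

section log_kernels

variable {N : ℕ}

lemma exp_mul_log_eq_rpow {t : ℝ} (ht : 0 < t) (δ c : ℝ) :
    Real.exp (δ * (c * Real.log t)) = t ^ (c * δ) := by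
  rw [Real.rpow_def_of_pos ht]
  congr 1
  ring

lemma ae_ne (hN : 1 ≤ N) (x : Sp N) : ∀ᵐ y : Sp N, y ≠ x := by
  have := nontrivial_sp hN
  simp [ae_iff]

lemma indicator_ball_eq (x y : Sp N) (a : ℝ) :
    (Metric.ball x 1).indicator (fun _ => a) y =
      (Metric.ball (0 : Sp N) 1).indicator (fun _ => a) (x - y) := by
  simp [indicator, dist_eq_norm, norm_sub_rev]

/-- The integrand of `𝓚_1 v(x)` against the weight `|x-y|^{-2δ}`, with `y = x - z`. -/
lemma KIntegrand_mul_exp_eq (v : Sp N → ℝ) {x y : Sp N} (hy : y ≠ x) (δ : ℝ) :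
    KIntegrand N 1 v x y * Real.exp (δ * (-2 * Real.log ‖x - y‖)) =
      (fun z => ((Metric.ball (0 : Sp N) 1).indicator (fun _ => v x) z - v (x - z)) *
        ‖z‖ ^ (-((N : ℝ) + 2 * δ))) (x - y) := by
  have h : 0 < ‖x - y‖ := norm_pos_iff.2 (sub_ne_zero.2 hy.symm)
  simp only [KIntegrand, q, tsub_self, pow_zero, mul_one, sub_sub_cancel]
  rw [exp_mul_log_eq_rpow h, indicator_ball_eq, mul_assoc, ← Real.rpow_add h]
  congr 2
  ring

/-- The Lipschitz bound gains one power of |z| at 0, which pays for 2δ < 1. At infinity the decay of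
v gains |z|^{-η}, which pays for negative δ as long as 2|δ| < η. Both signs of δ are needed to
control powers of the logarithm. -/
lemma integrable_indicator_sub_mul_rpow (hN : 1 ≤ N) {v : Sp N → ℝ} (hv : Continuous v)
    {Λ M C η R : ℝ} (hΛ : ∀ x y, |v x - v y| ≤ Λ * ‖x - y‖) (hM : ∀ y, |v y| ≤ M)
    (hC : ∀ y, 0 < ‖y‖ → R ≤ ‖y‖ → |v y| ≤ C * ‖y‖ ^ (-η)) (hη : 0 < η) (x : Sp N)
    {δ : ℝ} (hδ1 : |δ| < 1 / 2) (hδ2 : 2 * |δ| < η) :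
    Integrable (fun z => ((Metric.ball (0 : Sp N) 1).indicator (fun _ => v x) z - v (x - z)) *
        ‖z‖ ^ (-((N : ℝ) + 2 * δ))) := by
  have hm : Measurable (fun z => ((Metric.ball (0 : Sp N) 1).indicator (fun _ => v x) z -
      v (x - z)) * ‖z‖ ^ (-((N : ℝ) + 2 * δ))) :=
    ((measurable_const.indicator Metric.isOpen_ball.measurableSet).sub
      (by fun_prop : Continuous fun z => v (x - z)).measurable).mul (by fun_prop)
  have hM0 : 0 ≤ M := (abs_nonneg _).trans (hM x)
  have hδl := neg_abs_le δ
  have hδu := le_abs_self δ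
  -- Beyond this radius ‖x - z‖ ≥ ‖z‖/2 ≥ |R|, so the decay of v applies. Below it, the bound M‖z‖
  -- covers the points outside the unit ball.
  refine integrable_of_norm_le_rpow hN hm.aestronglyMeasurable (r := 1 + 2 * ‖x‖ + 2 * |R|)
    (a := 1 - ((N : ℝ) + 2 * δ)) (b := -η - ((N : ℝ) + 2 * δ)) (C := Λ + M)
    (D := |C| * (1 / 2) ^ (-η)) (by linarith) (by linarith) (by positivity)
    (fun z hz _ => ?_) (fun z hz => ?_)
  · have hz0 : 0 < ‖z‖ := norm_pos_iff.2 hz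
    have hΛ0 : 0 ≤ Λ := by
      have h := (abs_nonneg _).trans (hΛ z 0)
      rw [sub_zero] at h
      exact nonneg_of_mul_nonneg_left h hz0
    rw [abs_mul, abs_of_nonneg (Real.rpow_nonneg (norm_nonneg z) _), sub_eq_add_neg 1,
      Real.rpow_add hz0, Real.rpow_one, ← mul_assoc]
    gcongr
    by_cases hz1 : z ∈ Metric.ball (0 : Sp N) 1
    · rw [indicator_of_mem hz1]
      refine (hΛ _ _).trans ?_
      rw [sub_sub_cancel]
      gcongr
      linarith
    · rw [indicator_of_notMem hz1, zero_sub, abs_neg]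
      have hz2 : 1 ≤ ‖z‖ := by simpa using hz1
      calc |v (x - z)| ≤ M * 1 := by rw [mul_one]; exact hM _
        _ ≤ (Λ + M) * ‖z‖ := by gcongr; linarith
  · have hx0 := norm_nonneg x
    have hR0 := abs_nonneg R
    have hz0 : 0 < ‖z‖ := by linarith
    have hz1 : z ∉ Metric.ball (0 : Sp N) 1 := by
      simp only [mem_ball_zero_iff, not_lt]
      linarith
    have h1 : ‖z‖ * (1 / 2) ≤ ‖x - z‖ := by
      have h2 := norm_sub_norm_le z x
      rw [norm_sub_rev] at h2
      linarith
    have h3 := hC (x - z) (by linarith) (by linarith [le_abs_self R])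
    have h4 : ‖x - z‖ ^ (-η) ≤ (‖z‖ * (1 / 2)) ^ (-η) :=
      Real.rpow_le_rpow_of_nonpos (by positivity) h1 (by linarith)
    rw [Real.mul_rpow hz0.le (by positivity)] at h4
    rw [indicator_of_notMem hz1, zero_sub, abs_mul, abs_neg,
      abs_of_nonneg (Real.rpow_nonneg (norm_nonneg z) _), sub_eq_add_neg (-η), Real.rpow_add hz0,
      ← mul_assoc]
    gcongr
    calc |v (x - z)| ≤ |C| * ‖x - z‖ ^ (-η) := h3.trans (by gcongr; exact le_abs_self C)
      _ ≤ |C| * (‖z‖ ^ (-η) * (1 / 2) ^ (-η)) := by gcongr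
      _ = _ := by ring

lemma integrable_KIntegrand_mul_exp (hN : 1 ≤ N) {v : Sp N → ℝ} {x : Sp N} {δ : ℝ}
    (h : Integrable (fun z => ((Metric.ball (0 : Sp N) 1).indicator (fun _ => v x) z - v (x - z)) *
        ‖z‖ ^ (-((N : ℝ) + 2 * δ)))) :
    Integrable (fun y => KIntegrand N 1 v x y * Real.exp (δ * (-2 * Real.log ‖x - y‖))) := by
  refine (h.comp_sub_left x).congr ?_
  filter_upwards [ae_ne hN x] with y hy
  rw [KIntegrand_mul_exp_eq v hy]

/-- Expanding |x-y|^{-2σ} in powers of σ therefore produces exactly the integrands of 𝓚_{k+1}. -/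
lemma KIntegrand_succ (v : Sp N → ℝ) (x y : Sp N) (k : ℕ) :
    KIntegrand N (k + 1) v x y = KIntegrand N 1 v x y * (-2 * Real.log ‖x - y‖) ^ k := by
  simp only [KIntegrand, q, tsub_self, pow_zero, mul_one, add_tsub_cancel_right]
  ring

lemma fracConst_eq (σ : ℝ) : fracConst N σ = σ * kappa₁ N (-σ) := by
  simp only [fracConst, kappa₁]
  rw [show (-2 : ℝ) * -σ = 2 * σ by ring, show (N : ℝ) - 2 * -σ = N + 2 * σ by ring,
    ← sub_eq_add_neg]
  ring

lemma fracConst_mul_eq_kappa₂ {σ : ℝ} (h0 : 0 < σ) :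
    fracConst N σ * (π ^ ((N : ℝ) / 2) / (Real.Gamma (N / 2) * σ)) = kappa₂ N (-σ) := by
  have h8 : π ^ (-(N : ℝ) / 2) * π ^ ((N : ℝ) / 2) = 1 := by
    rw [← Real.rpow_add pi_pos, neg_div, neg_add_cancel, Real.rpow_zero]
  simp only [fracConst, kappa₂]
  rw [show (-2 : ℝ) * -σ = 2 * σ by ring, show (N : ℝ) - 2 * -σ = N + 2 * σ by ring,
    ← sub_eq_add_neg]
  calc _ = 2 ^ (2 * σ) * (π ^ (-(N : ℝ) / 2) * π ^ ((N : ℝ) / 2)) * (σ / σ) *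
      (Real.Gamma (((N : ℝ) + 2 * σ) / 2) / (Real.Gamma ((N : ℝ) / 2) * Real.Gamma (1 - σ))) := by
        ring
    _ = _ := by rw [h8, div_self h0.ne', mul_one, mul_one]

/-- For small orders the singular integral converges absolutely and splits into a local term and an
exponential integral. -/
lemma fracConst_mul_limit_eq (hN : 1 ≤ N) {v : Sp N → ℝ} {x : Sp N} {σ l : ℝ} (h0 : 0 < σ)
    (hi : Integrable (fun z => ((Metric.ball (0 : Sp N) 1).indicator (fun _ => v x) z -
      v (x - z)) * ‖z‖ ^ (-((N : ℝ) + 2 * σ))))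
    (hl : Tendsto (fracTruncated N σ v x) (𝓝[>] 0) (𝓝 l)) :
    fracConst N σ * l = kappa₂ N (-σ) * v x + σ * (kappa₁ N (-σ) *
      ∫ y, KIntegrand N 1 v x y * Real.exp (σ * (-2 * Real.log ‖x - y‖))) := by
  have hS : MeasurableSet (Metric.ball (0 : Sp N) 1)ᶜ := Metric.isOpen_ball.measurableSet.compl
  have hi2 : Integrable ((Metric.ball (0 : Sp N) 1)ᶜ.indicator
      fun z => v x * ‖z‖ ^ (-((N : ℝ) + 2 * σ))) :=
    (integrable_indicator_iff hS).2 (Integrable.const_mul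
      (integrableOn_compl_ball_norm_rpow (a := -((N : ℝ) + 2 * σ)) (by linarith) one_pos) _)
  have hsum : ∀ z : Sp N, ((Metric.ball (0 : Sp N) 1).indicator (fun _ => v x) z - v (x - z)) *
      ‖z‖ ^ (-((N : ℝ) + 2 * σ)) + (Metric.ball (0 : Sp N) 1)ᶜ.indicator
      (fun z => v x * ‖z‖ ^ (-((N : ℝ) + 2 * σ))) z =
      (v x - v (x - z)) * ‖z‖ ^ (-((N : ℝ) + 2 * σ)) := fun z => by
    by_cases hz : z ∈ Metric.ball (0 : Sp N) 1
    · rw [indicator_of_mem hz, indicator_of_notMem (by simpa using hz), add_zero]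
    · rw [indicator_of_notMem hz, indicator_of_mem (mem_compl hz)]
      ring
  have hi3 := (hi.add hi2).congr (Eventually.of_forall hsum)
  have hlim := tendsto_setIntegral_compl_ball hN hi3
  have htr : fracTruncated N σ v x = fun ε => ∫ z in (Metric.ball (0 : Sp N) ε)ᶜ,
      (v x - v (x - z)) * ‖z‖ ^ (-((N : ℝ) + 2 * σ)) := by
    funext ε
    rw [fracTruncated, fracIntegrand_eq]
    exact setIntegral_compl_ball_comp_sub
      (fun z => (v x - v (x - z)) * ‖z‖ ^ (-((N : ℝ) + 2 * σ))) x ε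
  rw [htr] at hl
  rw [tendsto_nhds_unique hl hlim, ← integral_congr_ae (Eventually.of_forall hsum)]
  have hadd := integral_add hi hi2
  rw [integral_indicator hS, integral_const_mul, integral_compl_ball_norm_rpow hN h0] at hadd
  have hJ : ∫ y, KIntegrand N 1 v x y * Real.exp (σ * (-2 * Real.log ‖x - y‖)) =
      ∫ z, ((Metric.ball (0 : Sp N) 1).indicator (fun _ => v x) z - v (x - z)) *
        ‖z‖ ^ (-((N : ℝ) + 2 * σ)) := by
    rw [← integral_sub_left_eq_self (fun z => ((Metric.ball (0 : Sp N) 1).indicator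
      (fun _ => v x) z - v (x - z)) * ‖z‖ ^ (-((N : ℝ) + 2 * σ))) _ x]
    refine integral_congr_ae ?_
    filter_upwards [ae_ne hN x] with y hy
    rw [KIntegrand_mul_exp_eq v hy]
  rw [hadd, hJ, mul_add, ← fracConst_mul_eq_kappa₂ h0, ← mul_assoc σ, ← fracConst_eq]
  ring

end log_kernels

/-! ### The two-sided expansion and its coefficients -/

section expansion

variable {N : ℕ} {u : Sp N → ℝ} {φ : 𝓢(Sp N, ℂ)} {s₀ : ℝ}

lemma powSymbol_mul_exp (s σ : ℝ) {ξ : Sp N} (hξ : ξ ≠ 0) :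
    powSymbol φ s ξ * (Real.exp (σ * (2 * Real.log (2 * π * ‖ξ‖))) : ℂ) =
      powSymbol φ (s + σ) ξ := by
  have hξ' : 0 < ‖ξ‖ := norm_pos_iff.2 hξ
  rw [powSymbol_add φ s σ hξ, exp_mul_log_eq_rpow (by positivity)]

/-- `s ↦ 𝓑^s u(x)` has a two-sided asymptotic power series at every point. -/
lemma exists_hasExpansion_B (hN : 1 ≤ N)
    (hB : ∀ s, -(N : ℝ) / 2 < s → ∀ x, (B N s u x : ℂ) = ∫ ξ, planeWave x ξ * powSymbol φ s ξ)
    (hs : -(N : ℝ) / 2 < s₀) (x : Sp N) :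
    ∃ c, HasExpansion (𝓝 0) (fun σ => B N (s₀ + σ) u x) c := by
  have hre : ∀ σ : ℝ, (fun ξ => (planeWave x ξ * powSymbol φ s₀ ξ).re *
      Real.exp (σ * (2 * Real.log (2 * π * ‖ξ‖)))) =ᵐ[volume]
      fun ξ => (planeWave x ξ * powSymbol φ (s₀ + σ) ξ).re := fun σ => by
    filter_upwards [ae_ne_zero hN] with ξ hξ
    rw [← powSymbol_mul_exp s₀ σ hξ, ← mul_assoc (planeWave x ξ), Complex.re_mul_ofReal]
  have hint : ∀ σ : ℝ, -(N : ℝ) / 2 < s₀ + σ →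
      Integrable fun ξ => planeWave x ξ * powSymbol φ (s₀ + σ) ξ := fun σ hσ =>
    integrable_planeWave_mul (integrable_powSymbol hN φ hσ) x
  have hint' : ∀ σ : ℝ, -(N : ℝ) / 2 < s₀ + σ →
      Integrable fun ξ => (planeWave x ξ * powSymbol φ s₀ ξ).re *
        Real.exp (σ * (2 * Real.log (2 * π * ‖ξ‖))) := fun σ hσ =>
    (hint σ hσ).re.congr (hre σ).symm
  -- Half the distance from s₀ to -N/2, so that s₀ ± δ both remain admissible orders.
  set δ := (s₀ + (N : ℝ) / 2) / 2 with hδ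
  have hδ0 : 0 < δ := by linarith
  refine ⟨_, (hasExpansion_integral_mul_exp hδ0 (by fun_prop) (hint' δ (by linarith))
    (hint' (-δ) (by linarith))).congr' ?_⟩
  filter_upwards [Ioi_mem_nhds (show -δ < 0 by linarith)] with σ hσ
  have hσ' : -(N : ℝ) / 2 < s₀ + σ := by
    have : -δ < σ := hσ
    linarith
  rw [integral_congr_ae (hre σ)]
  have h := integral_re (hint σ hσ')
  simp only [RCLike.re_to_complex] at h
  rw [h, ← hB _ hσ', Complex.ofReal_re]

lemma kappa₂_zero (hN : 1 ≤ N) : kappa₂ N 0 = 1 := by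
  have hN' : (0 : ℝ) < N := by exact_mod_cast hN
  have := Real.Gamma_pos_of_pos (show (0 : ℝ) < N / 2 by positivity)
  simp [kappa₂, this.ne']

/-- This lets the constant term of the expansion be treated as the case m = 0 of the general one. -/
lemma L_zero (hN : 1 ≤ N) (v : Sp N → ℝ) (x : Sp N) : L N 0 v x = v x := by
  simp [L, alpha, K, kappa₂_zero hN]

/-- The Cauchy product of the expansions of `kappa₂`, `kappa₁` and of the exponential integral
produces the operators `𝓛_m`. -/
lemma coeff_eq_L_div_factorial (v : Sp N → ℝ) (x : Sp N) (m : ℕ) :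
    (-1) ^ m * (iteratedDeriv m (kappa₂ N) 0 / m.factorial) * v x +
      (Nat.casesOn m 0 fun m => ∑ p ∈ Finset.HasAntidiagonal.antidiagonal m,
        ((-1) ^ p.1 * (iteratedDeriv p.1 (kappa₁ N) 0 / p.1.factorial)) *
          (K N (p.2 + 1) v x / p.2.factorial) : ℝ) = L N m v x / m.factorial := by
  cases m with
  | zero => simp [L, alpha, K]
  | succ m =>
    have hf : ((m + 1).factorial : ℝ) ≠ 0 := by exact_mod_cast (m + 1).factorial_ne_zero
    rw [eq_div_iff hf, L, Finset.sum_range_succ', add_comm, add_mul]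
    congr 1
    · change (∑ p ∈ Finset.HasAntidiagonal.antidiagonal m,
        ((-1) ^ p.1 * (iteratedDeriv p.1 (kappa₁ N) 0 / p.1.factorial)) *
          (K N (p.2 + 1) v x / p.2.factorial)) * _ = _
      -- The swap makes the summation index that of 𝓚, as in the definition of `L`.
      rw [← Finset.Nat.sum_antidiagonal_swap, Finset.Nat.sum_antidiagonal_eq_sum_range_succ_mk,
        Finset.sum_mul]
      refine Finset.sum_congr rfl fun k hk => ?_
      have hkm : k ≤ m := Nat.lt_succ_iff.1 (Finset.mem_range.1 hk)
      simp only [Prod.swap, alpha]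
      rw [show m + 1 - (k + 1) = m - k by omega, show m + 1 - 1 = m by omega,
        Nat.cast_choose ℝ hkm, Nat.factorial_succ]
      have h1 : (-1 : ℝ) ^ (m + 1 + (k + 1)) = (-1) ^ (m - k) := by
        rw [show m + 1 + (k + 1) = (m - k) + 2 * (k + 1) by omega, pow_add, pow_mul]
        simp
      rw [h1]
      have h2 : ((m - k).factorial : ℝ) ≠ 0 := by exact_mod_cast (m - k).factorial_ne_zero
      have h3 : (k.factorial : ℝ) ≠ 0 := by exact_mod_cast k.factorial_ne_zero
      push_cast
      field_simp
    · simp only [alpha, K]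
      field_simp

lemma HasExpansion.isLittleO {f : ℝ → ℝ} {c : ℕ → ℝ} (h : HasExpansion (𝓝 0) f c) (n : ℕ) :
    (fun σ => f σ - ∑ k ∈ Finset.range (n + 1), c k * σ ^ k) =o[𝓝 0] fun σ => σ ^ n :=
  (h (n + 1)).trans_isLittleO (isLittleO_pow_pow n.lt_succ_self)

/-- The Taylor expansion of `s ↦ 𝓑^s u(x)` at `s₀`, together with the absolute convergence of the
integrals in its coefficients. -/
lemma integrable_KIntegrand_and_hasExpansion (hN : 1 ≤ N) (hφ : ∀ x, φ x = (u x : ℂ)) {R : ℝ}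
    (hR : ∀ x, R < ‖x‖ → u x = 0) (hs : -(N : ℝ) / 2 < s₀) (x : Sp N) :
    (∀ k, Integrable (KIntegrand N (k + 1) (B N s₀ u) x)) ∧
    HasExpansion (𝓝 0) (fun σ => B N (s₀ + σ) u x)
      (fun m => L N m (B N s₀ u) x / m.factorial) := by
  have hB : ∀ s, -(N : ℝ) / 2 < s → ∀ x, (B N s u x : ℂ) =
      ∫ ξ, planeWave x ξ * powSymbol φ s ξ := fun s hs => (bSpec hN hφ hR hs).2.1
  obtain ⟨-, hv, η, hη, C, hC⟩ := bSpec hN hφ hR hs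
  set v := B N s₀ u with hvdef
  have hf := integrable_powSymbol hN φ hs
  have hvc : Continuous v := by
    have h := Complex.continuous_re.comp (continuous_of_planeWave hf hv)
    exact h.congr fun y => Complex.ofReal_re _
  have hM : ∀ y, |v y| ≤ ∫ ξ, ‖powSymbol φ s₀ ξ‖ := fun y => by
    have h := norm_le_of_planeWave hv y
    rwa [Complex.norm_real] at h
  -- A factor |2πξ| raises the order by 1/2, so this is integrability of the symbol at s₀ + 1/2; it
  -- makes v Lipschitz.
  have hΛi : Integrable fun ξ => 2 * π * ‖ξ‖ * ‖powSymbol φ s₀ ξ‖ := by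
    refine (integrable_powSymbol hN φ (s := s₀ + 1 / 2) (by linarith)).norm.congr ?_
    filter_upwards [ae_ne_zero hN] with ξ hξ
    rw [powSymbol_add φ _ _ hξ, norm_mul, Complex.norm_real, Real.norm_of_nonneg (by positivity),
      show (2 : ℝ) * (1 / 2) = 1 by norm_num, Real.rpow_one, mul_comm]
  have hΛ : ∀ y z, |v y - v z| ≤ (∫ ξ, 2 * π * ‖ξ‖ * ‖powSymbol φ s₀ ξ‖) * ‖y - z‖ := fun y z => by
    rw [← Real.norm_eq_abs, ← Complex.norm_real, Complex.ofReal_sub, hv, hv,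
      ← integral_sub (integrable_planeWave_mul hf _) (integrable_planeWave_mul hf _),
      ← integral_mul_const]
    refine norm_integral_le_of_norm_le (hΛi.mul_const _) (Eventually.of_forall fun ξ => ?_)
    rw [← sub_mul, norm_mul]
    have h := norm_planeWave_sub_le y z ξ
    calc _ ≤ (2 * π * ‖ξ‖ * ‖y - z‖) * ‖powSymbol φ s₀ ξ‖ := by gcongr
      _ = _ := by ring
  have hG : ∀ δ : ℝ, |δ| < 1 / 2 → 2 * |δ| < η → _ := fun δ h1 h2 =>
    integrable_indicator_sub_mul_rpow hN hvc hΛ hM hC hη x h1 h2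
  -- This choice satisfies both δ < 1/2 and 2δ < η.
  set δ := min (1 / 4) (η / 4) with hδ
  have hδ0 : 0 < δ := by positivity
  have hδ1 : δ ≤ 1 / 4 := min_le_left _ _
  have hδ2 : δ ≤ η / 4 := min_le_right _ _
  have hF1 := integrable_KIntegrand_mul_exp hN (hG δ (by rw [abs_of_pos hδ0]; linarith)
    (by rw [abs_of_pos hδ0]; linarith))
  have hF2 := integrable_KIntegrand_mul_exp hN (hG (-δ)
    (by rw [abs_neg, abs_of_pos hδ0]; linarith) (by rw [abs_neg, abs_of_pos hδ0]; linarith))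
  have hℓ : Measurable fun y : Sp N => -2 * Real.log ‖x - y‖ := by fun_prop
  have hK : ∀ k, Integrable (KIntegrand N (k + 1) v x) := fun k =>
    (integrable_mul_pow_of_integrable_mul_exp hδ0 hℓ hF1 hF2 k).congr
      (Eventually.of_forall fun y => (KIntegrand_succ v x y k).symm)
  refine ⟨hK, ?_⟩
  have hJ : HasExpansion (𝓝 0)
      (fun σ => ∫ y, KIntegrand N 1 v x y * Real.exp (σ * (-2 * Real.log ‖x - y‖)))
      (fun k => K N (k + 1) v x / k.factorial) := by
    have h := hasExpansion_integral_mul_exp hδ0 hℓ hF1 hF2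
    simp only [← KIntegrand_succ] at h
    exact h
  have hrhs := ((hasExpansion_kappa₂ hN).comp_neg.mul_const (v x)).add
    ((((hasExpansion_kappa₁ hN).comp_neg).mul le_rfl hJ).id_mul le_rfl)
  obtain ⟨c, hc⟩ := exists_hasExpansion_B hN hB hs x
  -- For small σ > 0 the singular integral of order σ applied to v has the symbol of order s₀ + σ,
  -- hence equals 𝓑^{s₀+σ}u(x), even when s₀ < 0 or when s₀ + σ exceeds 1.
  have hstar : ∀ᶠ σ in 𝓝[>] (0 : ℝ), kappa₂ N (-σ) * v x + σ * (kappa₁ N (-σ) *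
      ∫ y, KIntegrand N 1 v x y * Real.exp (σ * (-2 * Real.log ‖x - y‖))) = B N (s₀ + σ) u x := by
    filter_upwards [self_mem_nhdsWithin, nhdsWithin_le_nhds (Iio_mem_nhds hδ0)] with σ hσ0 hσδ
    have h0 : 0 < σ := hσ0
    have hσδ' : σ < δ := hσδ
    have hfs : Integrable fun ξ => powSymbol φ s₀ ξ * (((2 * π * ‖ξ‖) ^ (2 * σ) : ℝ) : ℂ) := by
      refine (integrable_powSymbol hN φ (s := s₀ + σ) (by linarith)).congr ?_
      filter_upwards [ae_ne_zero hN] with ξ hξ using powSymbol_add φ _ _ hξ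
    obtain ⟨l, hl, hl2⟩ := tendsto_fracTruncated hN h0 (by linarith) hf hfs hv x
    rw [integral_planeWave_mul_mul_eq hN (fun ξ hξ => powSymbol_add φ s₀ σ hξ) x,
      ← hB _ (by linarith)] at hl2
    rw [← Complex.ofReal_injective hl2]
    exact (fracConst_mul_limit_eq hN h0 (hG σ (by rw [abs_of_pos h0]; linarith)
      (by rw [abs_of_pos h0]; linarith)) hl).symm
  -- The two series agree for σ → 0⁺, so the two-sided series `c` has the explicit coefficients.
  have huniq := (hc.mono nhdsWithin_le_nhds).unique
    ((hrhs.mono nhdsWithin_le_nhds).congr' hstar)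
  rw [huniq] at hc
  convert hc using 2 with m
  exact (coeff_eq_L_div_factorial v x m).symm

end expansion

theorem corollary1p2 (N : ℕ) (hN : 1 ≤ N) (u : LogLap.Sp N → ℝ)
    (hu : ContDiff ℝ ∞ u) (hc : HasCompactSupport u) (x : LogLap.Sp N) :
    (∀ s : ℝ, -(N : ℝ) / 2 < s → LogLap.BConvergesAt N s u x) ∧
    (∀ s₀ : ℝ, -(N : ℝ) / 2 < s₀ → ∀ j : ℕ, 1 ≤ j →
      Integrable (LogLap.KIntegrand N j (LogLap.B N s₀ u) x)) ∧
    (∀ n : ℕ, 1 ≤ n →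
      (fun s : ℝ => LogLap.B N s u x -
        (u x + ∑ m ∈ Finset.Icc 1 n, s ^ m / (m.factorial : ℝ) * LogLap.L N m u x))
        =o[𝓝[≠] (0 : ℝ)] (fun s : ℝ => s ^ n)) ∧
    (∀ s₀ : ℝ, -(N : ℝ) / 2 < s₀ → ∀ n : ℕ, 1 ≤ n →
      (fun s : ℝ => LogLap.B N s u x -
        (LogLap.B N s₀ u x + ∑ m ∈ Finset.Icc 1 n,
          (s - s₀) ^ m / (m.factorial : ℝ) * LogLap.L N m (LogLap.B N s₀ u) x))
        =o[𝓝[≠] s₀] (fun s : ℝ => (s - s₀) ^ n)) := by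
  have hc' : HasCompactSupport fun x => (u x : ℂ) := hc.comp_left (g := Complex.ofReal) rfl
  have hu' : ContDiff ℝ ∞ fun x => (u x : ℂ) := Complex.ofRealCLM.contDiff.comp hu
  set φ : 𝓢(Sp N, ℂ) := hc'.toSchwartzMap hu'
  have hφ : ∀ x, φ x = (u x : ℂ) := fun x => rfl
  obtain ⟨R, hR⟩ : ∃ R : ℝ, ∀ x, R < ‖x‖ → u x = 0 := by
    obtain ⟨R, hR⟩ := hc.isCompact.isBounded.exists_norm_le
    refine ⟨R, fun x hx => ?_⟩
    by_contra h
    exact absurd (hR x (subset_tsupport _ h)) (not_le.2 hx)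
  have h4 : ∀ s₀ : ℝ, -(N : ℝ) / 2 < s₀ → ∀ n : ℕ, 1 ≤ n →
      (fun s : ℝ => LogLap.B N s u x -
        (LogLap.B N s₀ u x + ∑ m ∈ Finset.Icc 1 n,
          (s - s₀) ^ m / (m.factorial : ℝ) * LogLap.L N m (LogLap.B N s₀ u) x))
        =o[𝓝[≠] s₀] (fun s : ℝ => (s - s₀) ^ n) := by
    intro s₀ hs n _
    have h := (integrable_KIntegrand_and_hasExpansion hN hφ hR hs x).2.isLittleO n
    have ht : Tendsto (fun s : ℝ => s - s₀) (𝓝[≠] s₀) (𝓝 0) := by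
      have : Tendsto (fun s : ℝ => s - s₀) (𝓝 s₀) (𝓝 (s₀ - s₀)) :=
        (continuous_id.sub continuous_const).tendsto s₀
      rw [sub_self] at this
      exact this.mono_left nhdsWithin_le_nhds
    refine (h.comp_tendsto ht).congr_left fun s => ?_
    simp only [Function.comp]
    -- The term m = 0 is split off as 𝓑^{s₀}u(x), and the remaining sum is reindexed over 1 ≤ m ≤ n.
    rw [add_sub_cancel, Finset.sum_range_succ', L_zero hN, ← Finset.Ico_add_one_right_eq_Icc,
      Finset.sum_Ico_eq_sum_range, add_tsub_cancel_right, pow_zero, Nat.factorial_zero,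
      Nat.cast_one, div_one, mul_one, add_comm (B N s₀ u x)]
    congr 2
    refine Finset.sum_congr rfl fun k _ => ?_
    rw [add_comm 1 k]
    ring
  refine ⟨fun s hs => (bSpec hN hφ hR hs).1 x, fun s₀ hs j hj => ?_, fun n hn => ?_, h4⟩
  · obtain ⟨k, rfl⟩ := Nat.exists_eq_add_of_le' hj
    exact (integrable_KIntegrand_and_hasExpansion hN hφ hR hs x).1 k
  · have hN' : (0 : ℝ) < N := by exact_mod_cast hN
    have hB0 : B N 0 u = u := by
      funext y
      simp [B, laplacianPow, negLaplacianPow]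
    simpa only [hB0, sub_zero] using h4 0 (by linarith) n hn
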